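/- **Theorem.** Let $G=(V,E)$ be a finite simple undirected graph, $W\subseteq V$, and $k\ge 0$ an integer. For $S,T\subseteq V$, an $S$–$T$ separator is a set $X\subseteq V\setminus(S\cup T)$ such that $G-X$ has no path from $S$ to $T$; it is minimal if no proper subset of it is an $S$–$T$ separator. A minimal $S$–$T$ separator $X$ is *important* if $|X'|>|X|$ for every minimal $S$–$T$ separator $X'$ such that the set of vertices connected to $S$ in $G-X'$ strictly contains the set of vertices connected to $S$ in $G-X$. For $Y\subseteq V\setminus W$, the *shadow* $R_W(Y)$ is the set of vertices $v\in V\setminus (W\cup Y)$ that are not connected to $W$ in $G-Y$. The set $Y$ is *$k$-shadow-removable* with respect to $W$ if $Y\cap W=\emptyset$, $|Y|\le k$, for each $v\in R_W(Y)$ some important $\{v\}$–$W$ separator of size at most $k$ is contained in $Y$, and for each $v\in Y$ no important $\{v\}$–$W$ separator of size at most $k$ is contained in $Y$. There are a constant $c$ and a single randomized algorithm (a random-access machine program with unit-cost addition, subtraction and comparison, and fair coin flips) which, on input $(G,W,k)$ with $|V|=n$, for every outcome of the coin flips halts within $c\,k^{ck}(n+1)^{c}$ steps (with $0^0=1$),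 that is, within $k^{O(k)}n^{O(1)}$ time, and outputs a list $\mathcal Z$ of at most $c\,k^{ck}=k^{O(k)}$ vertex sets, all disjoint from $W$, such that the following holds. For every vertex set $Y$ that is $k$-shadow-removable with respect to $W$, with probability at least $0.99$ there is $Z\in\mathcal Z$ with $$Y\cap Z=\emptyset\qquad\text{and}\qquad R_W(Y)\subseteq Z .$$ -/

import Mathlib

/-! ## Separators and shadows -/

namespace ShadowRemoval

section Graphs

variable {V : Type*} [DecidableEq V]

/-- `u` and `v` are connected in `G - X`: some walk of `G` from `u` to `v` has no vertex in `X`. -/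
def ConnectedAvoiding (G : SimpleGraph V) (X : Finset V) (u v : V) : Prop :=
  ∃ p : G.Walk u v, ∀ x ∈ p.support, x ∉ X

/-- `X` is an `S`-`T` separator: it is disjoint from `S ∪ T`, and `G - X` has no path from `S`
to `T`. -/
def IsSeparator (G : SimpleGraph V) (S T X : Finset V) : Prop :=
  Disjoint X S ∧ Disjoint X T ∧ ∀ s ∈ S, ∀ t ∈ T, ¬ ConnectedAvoiding G X s t

/-- `X` is an inclusion-minimal `S`-`T` separator. -/
def IsMinimalSeparator (G : SimpleGraph V) (S T X : Finset V) : Prop :=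
  IsSeparator G S T X ∧ ∀ X' : Finset V, X' ⊂ X → ¬ IsSeparator G S T X'

/-- The set `C` of all vertices connected to `S` in `G - X`. -/
def sourceSide (G : SimpleGraph V) (S X : Finset V) : Set V :=
  {v | ∃ s ∈ S, ConnectedAvoiding G X s v}

/-- `X` is an important `S`-`T` separator: a minimal one such that every minimal `S`-`T` separator
with a strictly larger source side has strictly more vertices. -/
def IsImportantSeparator (G : SimpleGraph V) (S T X : Finset V) : Prop :=
  IsMinimalSeparator G S T X ∧
    ∀ X' : Finset V, IsMinimalSeparator G S T X' →
      sourceSide G S X ⊂ sourceSide G S X' → X.card < X'.card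

/-- The shadow of `Y` with respect to `W`: the vertices of `G - Y`, outside `W`, that are not
connected to `W` in `G - Y`. -/
def shadow (G : SimpleGraph V) (W Y : Finset V) : Set V :=
  {v | v ∉ W ∧ v ∉ Y ∧ ∀ w ∈ W, ¬ ConnectedAvoiding G Y v w}

/-- `Y` is `k`-shadow-removable with respect to `W`. -/
def IsShadowRemovable (G : SimpleGraph V) (k : ℕ) (W Y : Finset V) : Prop :=
  Disjoint W Y ∧ Y.card ≤ k ∧
    (∀ v ∈ shadow G W Y, ∃ X : Finset V,
      IsImportantSeparator G {v} W X ∧ X.card ≤ k ∧ X ⊆ Y) ∧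
    (∀ v ∈ Y, ∀ X : Finset V,
      IsImportantSeparator G {v} W X → X.card ≤ k → 1 ≤ (X \ Y).card)

end Graphs

/-! ## Randomized random-access programs

A structured random-access machine. A memory state has registers `x₀, x₁, …` and arrays
`A₀, A₁, …`, all of whose entries are natural numbers. Each elementary operation costs one step.
There is no multiplication, so that numbers gain at most one bit per operation and the model is
polynomially equivalent to Turing machines. A program can flip fair coins. -/

/-- Expressions: constants, registers, array entries, sum, truncated difference, and comparisons
with value `1` (true) or `0` (false). -/
inductive Expr : Type
  | const (m : ℕ)
  | reg (x : ℕ)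
  | get (a : ℕ) (i : Expr)
  | add (e f : Expr)
  | sub (e f : Expr)
  | lt (e f : Expr)
  | eq (e f : Expr)

/-- Programs. In `ite` and `loop` a condition is true if its value is nonzero. -/
inductive Prog : Type
  | skip
  | assign (x : ℕ) (e : Expr)
  | put (a : ℕ) (i e : Expr)
  | flip (x : ℕ)
  | seq (p q : Prog)
  | ite (e : Expr) (p q : Prog)
  | loop (e : Expr) (p : Prog)

/-- A memory state, together with the number of coins flipped so far. -/
structure State : Type where
  reg : ℕ → ℕ
  arr : ℕ → ℕ → ℕ
  coins : ℕ

/-- The value of an expression. -/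
def Expr.eval (s : State) : Expr → ℕ
  | .const m => m
  | .reg x => s.reg x
  | .get a i => s.arr a (i.eval s)
  | .add e f => e.eval s + f.eval s
  | .sub e f => e.eval s - f.eval s
  | .lt e f => if e.eval s < f.eval s then 1 else 0
  | .eq e f => if e.eval s = f.eval s then 1 else 0

/-- The number of steps needed to evaluate an expression: one for each of its nodes. -/
def Expr.cost : Expr → ℕ
  | .const _ => 1
  | .reg _ => 1
  | .get _ i => i.cost + 1
  | .add e f => e.cost + f.cost + 1
  | .sub e f => e.cost + f.cost + 1
  | .lt e f => e.cost + f.cost + 1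
  | .eq e f => e.cost + f.cost + 1

/-- The state after storing `m` in register `x`. -/
def State.setReg (s : State) (x m : ℕ) : State :=
  { s with reg := Function.update s.reg x m }

/-- The state after storing `m` in entry `i` of array `a`. -/
def State.setArr (s : State) (a i m : ℕ) : State :=
  { s with arr := Function.update s.arr a (Function.update (s.arr a) i m) }

/-- `Exec ω p s s' t`: with the sequence `ω` of coin outcomes, the program `p` started in state `s`
halts in state `s'` after exactly `t` steps. -/
inductive Exec (ω : ℕ → Bool) : Prog → State → State → ℕ → Prop
  | skip (s : State) : Exec ω .skip s s 1
  | assign (x : ℕ) (e : Expr) (s : State) :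
      Exec ω (.assign x e) s (s.setReg x (e.eval s)) (e.cost + 1)
  | put (a : ℕ) (i e : Expr) (s : State) :
      Exec ω (.put a i e) s (s.setArr a (i.eval s) (e.eval s)) (i.cost + e.cost + 1)
  | flip (x : ℕ) (s : State) :
      Exec ω (.flip x) s
        { s.setReg x (if ω s.coins = true then 1 else 0) with coins := s.coins + 1 } 1
  | seq {p q : Prog} {s s' s'' : State} {t t' : ℕ} :
      Exec ω p s s' t → Exec ω q s' s'' t' → Exec ω (.seq p q) s s'' (t + t')
  | iteTrue {e : Expr} {p q : Prog} {s s' : State} {t : ℕ} :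
      e.eval s ≠ 0 → Exec ω p s s' t → Exec ω (.ite e p q) s s' (e.cost + 1 + t)
  | iteFalse {e : Expr} {p q : Prog} {s s' : State} {t : ℕ} :
      e.eval s = 0 → Exec ω q s s' t → Exec ω (.ite e p q) s s' (e.cost + 1 + t)
  | loopDone {e : Expr} {p : Prog} {s : State} :
      e.eval s = 0 → Exec ω (.loop e p) s s (e.cost + 1)
  | loopStep {e : Expr} {p : Prog} {s s' s'' : State} {t t' : ℕ} :
      e.eval s ≠ 0 → Exec ω p s s' t → Exec ω (.loop e p) s' s'' t' →
        Exec ω (.loop e p) s s'' (e.cost + 1 + t + t')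

/-- The final state and the number of steps are determined by the coin outcomes. -/
theorem Exec.unique {ω : ℕ → Bool} {p : Prog} {s s₁ : State} {t₁ : ℕ}
    (h₁ : Exec ω p s s₁ t₁) :
    ∀ {s₂ : State} {t₂ : ℕ}, Exec ω p s s₂ t₂ → s₁ = s₂ ∧ t₁ = t₂ := by
  induction h₁ with
  | skip | assign | put | flip => intro _ _ h; cases h; exact ⟨rfl, rfl⟩
  | seq _ _ ih ih' =>
    intro _ _ h
    cases h with
    | seq a b =>
      obtain ⟨rfl, rfl⟩ := ih a
      obtain ⟨rfl, rfl⟩ := ih' b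
      exact ⟨rfl, rfl⟩
  | iteTrue he _ ih =>
    intro _ _ h
    cases h with
    | iteTrue _ a => obtain ⟨rfl, rfl⟩ := ih a; exact ⟨rfl, rfl⟩
    | iteFalse he' _ => exact absurd he' he
  | iteFalse he _ ih =>
    intro _ _ h
    cases h with
    | iteTrue he' _ => exact absurd he he'
    | iteFalse _ a => obtain ⟨rfl, rfl⟩ := ih a; exact ⟨rfl, rfl⟩
  | loopDone he =>
    intro _ _ h
    cases h with
    | loopDone => exact ⟨rfl, rfl⟩
    | loopStep he' _ _ => exact absurd he he'
  | loopStep he _ _ ih ih' =>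
    intro _ _ h
    cases h with
    | loopDone he' => exact absurd he' he
    | loopStep _ a b =>
      obtain ⟨rfl, rfl⟩ := ih a
      obtain ⟨rfl, rfl⟩ := ih' b
      exact ⟨rfl, rfl⟩

/-- The law of an infinite sequence of independent fair coin flips. -/
noncomputable def coinMeasure : MeasureTheory.Measure (ℕ → Bool) :=
  MeasureTheory.Measure.infinitePi fun _ => (PMF.uniformOfFintype Bool).toMeasure

open Classical in
/-- The initial state on input `(G, W, k)`: register `0` holds `n`, register `1` holds `k`, array
`0` holds the adjacency matrix of `G` row by row, array `1` the indicator of `W`, and everything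
else is `0`. -/
noncomputable def inputState {n : ℕ} (G : SimpleGraph (Fin n)) (W : Finset (Fin n)) (k : ℕ) :
    State where
  reg x := if x = 0 then n else if x = 1 then k else 0
  arr a m :=
    if a = 0 then (if ∃ i j : Fin n, m = i.val * n + j.val ∧ G.Adj i j then 1 else 0)
    else if a = 1 then (if ∃ i : Fin n, m = i.val ∧ i ∈ W then 1 else 0)
    else 0
  coins := 0

/-- The list of vertex sets output in a final state: register `2` holds their number, and array `2`
holds their indicator vectors, one after the other. -/
def State.output (n : ℕ) (s : State) : List (Finset (Fin n)) :=
  (List.range (s.reg 2)).map fun j =>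
    Finset.univ.filter fun i : Fin n => s.arr 2 (j * n + i.val) ≠ 0

end ShadowRemoval

namespace ShadowRemoval

/-! ## Vertex boundaries, components and important separators -/

section Boundary

set_option linter.unusedSectionVars false

variable {V : Type*} [Fintype V] [DecidableEq V]

/-! Fix `Y` and a vertex `v` in `Y`. There may be exponentially many important `{v}`-`W` separators
of size at most `k`, yet `k + 1` vertices outside `Y` hit them all (`exists_hitting_set`). The
reason is a single chain of cuts. Among the sides of a source set `S` with smallest boundary,
submodularity provides a largest one, `M`, and its boundary is important
(`IsFurthest.isImportantSeparator`); if it has size at most `k`, it therefore has a vertex `x`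
outside `Y`. An important separator with `S` on its source side either contains `x` or has `x` on
its source side (`IsImportantSeparator.boundary_furthest_subset`). In the second case `x` and the
component of `M` may be added to `S`, which raises the minimum boundary, so the chain has at most `k
+ 1` steps. The union `H` of these sets over `Y` misses `Y` and has at most `k * (k + 1)` vertices.

For `k > 0`, keep every vertex independently with a probability `p` that is a power of `1/2` between
`1/(4k)` and `1/(2k)`. The kept set `U` contains `Y` and misses `H` with probability at least `p^k
(1 - p)^(k(k+1)) ≥ p^k 2^-(k+1)`, which is `k^(-O(k))`; hence `k^O(k)` trials contain a good one
with probability `0.99` (`le_coinMeasure_exists_trial`). A trial outputs the vertices outside `W`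
for which `U` contains an important separator of size at most `k`. A shadow vertex has one inside
`Y`, hence inside `U`; a vertex of `Y` has none, because `H` would meet it.

Membership in the output is decided in polynomial time by the same chain of cuts, with `U` in the
role of `Y`: vertices of the furthest minimum cut outside `U` become sources, and if there are none,
the cut itself is the separator sought. The cuts come from augmenting paths in the split digraph
(`SearchInv`, `SearchInv.saturated`, `decideProg_spec`). The flow survives the growth of the source
set, and each unfinished round raises the flow value or the number of sources, so `n + k + 2` rounds
suffice. The loops of the program are counting loops of known length, so the running time is
polynomial in the largest length (`Prog.exists_time_le`). -/

open Classical in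
/-- The outer vertex boundary of `A`. -/
noncomputable def boundary (G : SimpleGraph V) (A : Finset V) : Finset V :=
  Finset.univ.filter fun x => x ∉ A ∧ ∃ y ∈ A, G.Adj y x

open Classical in
/-- The vertices reachable from `v` by walks inside `A`. -/
noncomputable def component (G : SimpleGraph V) (A : Finset V) (v : V) : Finset V :=
  Finset.univ.filter fun y => ∃ p : G.Walk v y, ∀ x ∈ p.support, x ∈ A

theorem mem_boundary {G : SimpleGraph V} {A : Finset V} {x : V} :
    x ∈ boundary G A ↔ x ∉ A ∧ ∃ y ∈ A, G.Adj y x := by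
  simp [boundary]

theorem mem_component {G : SimpleGraph V} {A : Finset V} {v y : V} :
    y ∈ component G A v ↔ ∃ p : G.Walk v y, ∀ x ∈ p.support, x ∈ A := by
  simp [component]

theorem mem_component_compl {G : SimpleGraph V} {X : Finset V} {v y : V} :
    y ∈ component G Xᶜ v ↔ ConnectedAvoiding G X v y := by
  simp [mem_component, ConnectedAvoiding]

/-- The union of the two boundaries on the left lies in the union of those on the right, and
likewise for the intersections. -/
theorem boundary_submodular (G : SimpleGraph V) (A B : Finset V) :
    (boundary G (A ∪ B)).card + (boundary G (A ∩ B)).card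
      ≤ (boundary G A).card + (boundary G B).card := by
  rw [← Finset.card_union_add_card_inter, ← Finset.card_union_add_card_inter (boundary G A)]
  apply Nat.add_le_add <;> apply Finset.card_le_card <;> intro x <;>
    simp only [Finset.mem_union, Finset.mem_inter, mem_boundary]
  · rintro (⟨h, y, hy, hxy⟩ | ⟨h, y, hy, hxy⟩)
    · rcases hy with hy | hy
      · exact Or.inl ⟨fun h' => h (Or.inl h'), y, hy, hxy⟩
      · exact Or.inr ⟨fun h' => h (Or.inr h'), y, hy, hxy⟩
    · by_cases hA : x ∈ A
      · exact Or.inr ⟨fun h' => h ⟨hA, h'⟩, y, hy.2, hxy⟩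
      · exact Or.inl ⟨hA, y, hy.1, hxy⟩
  · rintro ⟨⟨h, -⟩, ⟨-, y, hy, hxy⟩⟩
    exact ⟨⟨fun h' => h (Or.inl h'), y, hy.1, hxy⟩, ⟨fun h' => h (Or.inr h'), y, hy.2, hxy⟩⟩

theorem component_subset (G : SimpleGraph V) (A : Finset V) (v : V) : component G A v ⊆ A := by
  intro y hy
  obtain ⟨p, hp⟩ := mem_component.1 hy
  exact hp y p.end_mem_support

theorem component_mono (G : SimpleGraph V) {A B : Finset V} (h : A ⊆ B) (v : V) :
    component G A v ⊆ component G B v := by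
  intro y hy
  obtain ⟨p, hp⟩ := mem_component.1 hy
  exact mem_component.2 ⟨p, fun x hx => h (hp x hx)⟩

theorem self_mem_component {G : SimpleGraph V} {A : Finset V} {v : V} (h : v ∈ A) :
    v ∈ component G A v :=
  mem_component.2 ⟨.nil, by simpa using h⟩

theorem component_step {G : SimpleGraph V} {A : Finset V} {v y z : V}
    (hy : y ∈ component G A v) (h : G.Adj y z) (hz : z ∈ A) : z ∈ component G A v := by
  obtain ⟨p, hp⟩ := mem_component.1 hy
  refine mem_component.2 ⟨p.concat h, fun x hx => ?_⟩
  rw [SimpleGraph.Walk.support_concat, List.mem_append] at hx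
  rcases hx with hx | hx
  · exact hp x hx
  · rw [List.mem_singleton.1 hx]; exact hz

theorem component_induction {G : SimpleGraph V} {A : Finset V} {v : V} {P : V → Prop}
    (hv : P v) (hstep : ∀ y z, P y → G.Adj y z → z ∈ A → P z) :
    ∀ y ∈ component G A v, P y := by
  intro y hy
  obtain ⟨p, hp⟩ := mem_component.1 hy
  clear hy
  induction p with
  | nil => exact hv
  | cons h q ih =>
    refine ih (hstep _ _ hv h (hp _ ?_)) fun x hx => hp x ?_
    · simp
    · simp [hx]

theorem component_component (G : SimpleGraph V) (A : Finset V) (v : V) :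
    component G (component G A v) v = component G A v := by
  refine (component_subset _ _ _).antisymm fun y hy => ?_
  have hv : v ∈ A := by
    obtain ⟨p, hp⟩ := mem_component.1 hy
    exact hp v p.start_mem_support
  exact (component_induction (P := fun y => y ∈ component G A v ∧
      y ∈ component G (component G A v) v)
    ⟨self_mem_component hv, self_mem_component (self_mem_component hv)⟩
    (fun y z hP h hz => ⟨component_step hP.1 h hz,
      component_step hP.2 h (component_step hP.1 h hz)⟩) y hy).2

theorem boundary_component_subset (G : SimpleGraph V) (A : Finset V) (v : V) :
    boundary G (component G A v) ⊆ boundary G A := by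
  intro x hx
  obtain ⟨h, y, hy, hxy⟩ := mem_boundary.1 hx
  exact mem_boundary.2 ⟨fun hA => h (component_step hy hxy hA), y, component_subset _ _ _ hy, hxy⟩

theorem component_subset_compl_boundary (G : SimpleGraph V) {A : Finset V} {v : V} (hv : v ∈ A) :
    component G (boundary G A)ᶜ v ⊆ A := by
  refine component_induction (P := fun y => y ∈ A) hv fun y z hy h hz => ?_
  by_contra hzA
  exact (Finset.mem_compl.1 hz) (mem_boundary.2 ⟨hzA, y, hy, h⟩)

theorem subset_compl_boundary (G : SimpleGraph V) (A : Finset V) : A ⊆ (boundary G A)ᶜ := by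
  intro x hx
  simp [mem_boundary, hx]

/-- A walk from `v` can leave `A` only through the boundary of `A`. This translates between sides
and source sides of separators. -/
theorem component_compl_boundary (G : SimpleGraph V) {A : Finset V} {v : V} (hv : v ∈ A) :
    component G (boundary G A)ᶜ v = component G A v := by
  refine subset_antisymm ?_ (component_mono G (subset_compl_boundary G A) v)
  rw [← component_component G (boundary G A)ᶜ v]
  exact component_mono G (component_subset_compl_boundary G hv) v

theorem sourceSide_singleton (G : SimpleGraph V) (v : V) (X : Finset V) :
    sourceSide G {v} X = (component G Xᶜ v : Set V) := by
  ext y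
  simp [sourceSide, mem_component_compl]

/-! ### Sides and their correspondence with separators -/

/-- `A` contains `S`, and neither `A` nor its boundary meets `W`. -/
def IsSide (G : SimpleGraph V) (W S A : Finset V) : Prop :=
  S ⊆ A ∧ Disjoint A W ∧ Disjoint (boundary G A) W

theorem IsSide.mono {G : SimpleGraph V} {W S S' A : Finset V} (h : IsSide G W S A)
    (hS : S' ⊆ S) : IsSide G W S' A :=
  ⟨hS.trans h.1, h.2⟩

theorem IsSide.component {G : SimpleGraph V} {W S A : Finset V} {v : V} (h : IsSide G W S A)
    (hS : S ⊆ component G A v) : IsSide G W S (component G A v) :=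
  ⟨hS, Finset.disjoint_of_subset_left (component_subset G A v) h.2.1,
    Finset.disjoint_of_subset_left (boundary_component_subset G A v) h.2.2⟩

theorem IsSide.union {G : SimpleGraph V} {W S A B : Finset V} (hA : IsSide G W S A)
    (hB : IsSide G W S B) : IsSide G W S (A ∪ B) := by
  refine ⟨hA.1.trans Finset.subset_union_left, ?_, ?_⟩
  · rw [Finset.disjoint_union_left]; exact ⟨hA.2.1, hB.2.1⟩
  · rw [Finset.disjoint_left]
    intro x hx hxW
    obtain ⟨h, y, hy, hxy⟩ := mem_boundary.1 hx
    simp only [Finset.mem_union, not_or] at h hy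
    rcases hy with hy | hy
    · exact Finset.disjoint_left.1 hA.2.2 (mem_boundary.2 ⟨h.1, y, hy, hxy⟩) hxW
    · exact Finset.disjoint_left.1 hB.2.2 (mem_boundary.2 ⟨h.2, y, hy, hxy⟩) hxW

theorem IsSide.inter {G : SimpleGraph V} {W S A B : Finset V} (hA : IsSide G W S A)
    (hB : IsSide G W S B) : IsSide G W S (A ∩ B) := by
  refine ⟨Finset.subset_inter hA.1 hB.1,
    Finset.disjoint_of_subset_left Finset.inter_subset_left hA.2.1, ?_⟩
  rw [Finset.disjoint_left]
  intro x hx hxW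
  obtain ⟨h, y, hy, hxy⟩ := mem_boundary.1 hx
  simp only [Finset.mem_inter, not_and] at h hy
  exact Finset.disjoint_left.1 hA.2.2
    (mem_boundary.2 ⟨fun h' => Finset.disjoint_left.1 hA.2.1 h' hxW, y, hy.1, hxy⟩) hxW

theorem IsSide.isSeparator {G : SimpleGraph V} {W A : Finset V} {v : V}
    (h : IsSide G W {v} A) : IsSeparator G {v} W (boundary G A) := by
  have hv : v ∈ A := h.1 (Finset.mem_singleton_self v)
  refine ⟨?_, h.2.2, ?_⟩
  · simp [mem_boundary, hv]
  · intro s hs w hw hc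
    rw [Finset.mem_singleton.1 hs, ← mem_component_compl] at hc
    exact Finset.disjoint_left.1 h.2.1 (component_subset_compl_boundary G hv hc) hw

theorem boundary_component_compl_subset (G : SimpleGraph V) (X : Finset V) (v : V) :
    boundary G (component G Xᶜ v) ⊆ X := by
  intro x hx
  obtain ⟨h, y, hy, hxy⟩ := mem_boundary.1 hx
  by_contra hX
  exact h (component_step hy hxy (Finset.mem_compl.2 hX))

theorem IsSeparator.isSide {G : SimpleGraph V} {W X : Finset V} {v : V}
    (h : IsSeparator G {v} W X) : IsSide G W {v} (component G Xᶜ v) := by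
  obtain ⟨h1, h2, h3⟩ := h
  refine ⟨?_, ?_, Finset.disjoint_of_subset_left (boundary_component_compl_subset G X v) h2⟩
  · rw [Finset.singleton_subset_iff]
    exact self_mem_component (by simpa using h1)
  · rw [Finset.disjoint_left]
    intro x hx hw
    exact h3 v (Finset.mem_singleton_self v) x hw (mem_component_compl.1 hx)

theorem IsMinimalSeparator.boundary_eq {G : SimpleGraph V} {W X : Finset V} {v : V}
    (h : IsMinimalSeparator G {v} W X) : boundary G (component G Xᶜ v) = X := by
  by_contra hne
  exact h.2 _ ((boundary_component_compl_subset G X v).ssubset_of_ne hne) h.1.isSide.isSeparator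

theorem IsSeparator.exists_minimal {G : SimpleGraph V} {S W X : Finset V}
    (h : IsSeparator G S W X) : ∃ X' ⊆ X, IsMinimalSeparator G S W X' := by
  induction X using Finset.strongInduction with
  | H X ih =>
    by_cases hX : ∃ X' ⊂ X, IsSeparator G S W X'
    · obtain ⟨X', hX', hs⟩ := hX
      obtain ⟨X'', h1, h2⟩ := ih X' hX' hs
      exact ⟨X'', h1.trans hX'.subset, h2⟩
    · push Not at hX
      exact ⟨X, subset_rfl, h, hX⟩

/-- A side that contains the source side of an important separator, and has no larger boundary,
reaches nothing more from the source. -/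
theorem IsImportantSeparator.component_subset {G : SimpleGraph V} {W X A : Finset V} {v : V}
    (h : IsImportantSeparator G {v} W X) (hA : IsSide G W {v} A)
    (hXA : component G Xᶜ v ⊆ A) (hc : (boundary G A).card ≤ X.card) :
    component G A v ⊆ component G Xᶜ v := by
  -- Importance speaks only of minimal separators, so the boundary of `A` is first shrunk to a
  -- minimal one; this can only enlarge the source side.
  obtain ⟨X', hX', hmin⟩ := hA.isSeparator.exists_minimal
  have hAX' : component G A v ⊆ component G X'ᶜ v :=
    component_mono G ((subset_compl_boundary G A).trans (Finset.compl_subset_compl.2 hX')) v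
  have hXX' : component G Xᶜ v ⊆ component G X'ᶜ v := by
    rw [← component_component G Xᶜ v]
    exact (component_mono G hXA v).trans hAX'
  have hnot : ¬ component G Xᶜ v ⊂ component G X'ᶜ v := by
    intro hss
    have := h.2 X' hmin (by simpa only [sourceSide_singleton, Finset.coe_ssubset] using hss)
    have := Finset.card_le_card hX'
    omega
  have : component G X'ᶜ v = component G Xᶜ v := by
    by_contra hne
    exact hnot (hXX'.ssubset_of_ne fun h => hne h.symm)
  exact this ▸ hAX'

/-- A side of smallest boundary stays inside the source side of every important separator. -/
theorem IsImportantSeparator.component_minimum_subset {G : SimpleGraph V} {W S X M : Finset V}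
    {v : V} (h : IsImportantSeparator G {v} W X) (hv : v ∈ S)
    (hS : S ⊆ component G Xᶜ v) (hM : IsSide G W S M)
    (hmin : ∀ A, IsSide G W S A → (boundary G M).card ≤ (boundary G A).card) :
    component G M v ⊆ component G Xᶜ v := by
  have hC : IsSide G W S (component G Xᶜ v) := ⟨hS, h.1.1.isSide.2⟩
  -- The intersection is a side of `S`, so its boundary is at least that of `M`; hence the union has
  -- boundary at most `X.card`, and importance of `X` applies to it.
  have h1 := boundary_submodular G M (component G Xᶜ v)
  have h2 := hmin _ (hM.inter hC)
  rw [h.1.boundary_eq] at h1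
  have h3 := h.component_subset ((hM.union hC).mono (Finset.singleton_subset_iff.2 hv))
    Finset.subset_union_right (by omega)
  exact (component_mono G Finset.subset_union_left v).trans h3

/-! ### Furthest minimum sides and hitting sets -/

/-- `M` is the largest among the sides of `S` of smallest boundary. -/
def IsFurthest (G : SimpleGraph V) (W S M : Finset V) : Prop :=
  IsSide G W S M ∧ ∀ A, IsSide G W S A → (boundary G M).card ≤ (boundary G A).card ∧
    ((boundary G A).card ≤ (boundary G M).card → A ⊆ M)

/-- By submodularity the sides of smallest boundary are closed under union, so one of largest
cardinality contains all the others. -/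
theorem IsSide.exists_isFurthest {G : SimpleGraph V} {W S A : Finset V} (h : IsSide G W S A) :
    ∃ M, IsFurthest G W S M := by
  classical
  obtain ⟨M₀, hM₀, hmin⟩ := Finset.exists_min_image
    (Finset.univ.filter fun A => IsSide G W S A) (fun A => (boundary G A).card)
    ⟨A, by simpa using h⟩
  simp only [Finset.mem_filter, Finset.mem_univ, true_and] at hM₀ hmin
  obtain ⟨M, hM, hmax⟩ := Finset.exists_max_image
    (Finset.univ.filter fun A => IsSide G W S A ∧ (boundary G A).card ≤ (boundary G M₀).card)
    (fun A => A.card) ⟨M₀, by simpa using hM₀⟩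
  simp only [Finset.mem_filter, Finset.mem_univ, true_and] at hM hmax
  refine ⟨M, hM.1, fun A hA => ⟨hM.2.trans (hmin A hA), fun hle => ?_⟩⟩
  have h1 := boundary_submodular G M A
  have h2 := hmin _ (hM.1.inter hA)
  have h3 := hmax (M ∪ A) ⟨hM.1.union hA, by omega⟩
  have := Finset.eq_of_subset_of_card_le Finset.subset_union_left h3
  rw [this]
  exact Finset.subset_union_right

theorem IsFurthest.boundary_component {G : SimpleGraph V} {W S M : Finset V} {v : V}
    (h : IsFurthest G W S M) (hS : S ⊆ component G M v) :
    boundary G (component G M v) = boundary G M :=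
  Finset.eq_of_subset_of_card_le (boundary_component_subset G M v) (h.2 _ (h.1.component hS)).1

/-- The boundary of the furthest side of `S` is an important separator. -/
theorem IsFurthest.isImportantSeparator {G : SimpleGraph V} {W S M : Finset V} {v : V}
    (h : IsFurthest G W S M) (hv : v ∈ S) (hS : S ⊆ component G M v) :
    IsImportantSeparator G {v} W (boundary G M) := by
  have hvM : v ∈ M := h.1.1 hv
  have hcomp := component_compl_boundary G hvM
  -- A separator whose source side contains the component of `M` has a side of `S` as its source
  -- side. It is thus no smaller than the boundary of `M`, and in case of equality it reaches
  -- nothing more. The first fact gives minimality, the second importance.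
  have key : ∀ X, IsSeparator G {v} W X → component G M v ⊆ component G Xᶜ v →
      (boundary G M).card ≤ X.card ∧
        (X.card ≤ (boundary G M).card → component G Xᶜ v ⊆ component G M v) := by
    intro X hX hsub
    have h1 := h.2 (component G Xᶜ v) ⟨hS.trans hsub, hX.isSide.2⟩
    have h2 := Finset.card_le_card (boundary_component_compl_subset G X v)
    refine ⟨h1.1.trans h2, fun h3 => ?_⟩
    rw [← component_component G Xᶜ v]
    exact component_mono G (h1.2 (h2.trans h3)) v
  refine ⟨⟨(h.1.mono (Finset.singleton_subset_iff.2 hv)).isSeparator, fun X' hX' hsep => ?_⟩,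
    fun X' hX' hss => ?_⟩
  · have h1 := (key X' hsep (hcomp ▸
      component_mono G (Finset.compl_subset_compl.2 hX'.subset) v)).1
    have h2 := Finset.card_lt_card hX'
    omega
  · rw [sourceSide_singleton, sourceSide_singleton, Finset.coe_ssubset, hcomp] at hss
    have h1 := key X' hX'.1 hss.subset
    by_contra hle
    exact hss.not_subset (h1.2 (by omega))

/-- Each boundary vertex has a neighbour in the component of `M`, which lies inside the source side
of `X`; such a vertex is cut by `X` or reached. This dichotomy drives both the hitting set and the
search algorithm. -/
theorem IsImportantSeparator.boundary_furthest_subset {G : SimpleGraph V} {W S X M : Finset V}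
    {v : V} (h : IsImportantSeparator G {v} W X) (hv : v ∈ S)
    (hS : S ⊆ component G Xᶜ v) (hM : IsFurthest G W S M) (hSM : S ⊆ component G M v) :
    boundary G M ⊆ component G Xᶜ v ∪ X := by
  intro x hx
  rw [← hM.boundary_component hSM] at hx
  obtain ⟨-, y, hy, hxy⟩ := mem_boundary.1 hx
  have hy' := h.component_minimum_subset hv hS hM.1 (fun A hA => (hM.2 A hA).1) hy
  rw [Finset.mem_union]
  by_cases hX : x ∈ X
  · exact Or.inr hX
  · exact Or.inl (component_step hy' hxy (Finset.mem_compl.2 hX))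

/-- Induction on the gap `j` between `k + 1` and the smallest boundary of a side of `S`. There is no
branching: separators that contain the chosen vertex are already hit, so only those that leave it on
the source side go on. -/
theorem exists_hitting_set_aux (G : SimpleGraph V) (W Y : Finset V) (k : ℕ) (v : V)
    (hY : ∀ X, IsImportantSeparator G {v} W X → X.card ≤ k → ¬ X ⊆ Y) (j : ℕ) :
    ∀ S : Finset V, v ∈ S → S ⊆ component G S v →
      (∀ A, IsSide G W S A → k < (boundary G A).card + j) →
      ∃ H : Finset V, H.card ≤ j ∧ Disjoint H Y ∧
        ∀ X, IsImportantSeparator G {v} W X → X.card ≤ k → S ⊆ component G Xᶜ v →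
          ¬ Disjoint X H := by
  induction j with
  | zero =>
    intro S hv hS hlarge
    refine ⟨∅, le_rfl, by simp, fun X hX hk hSX => ?_⟩
    have := hlarge _ ⟨hSX, hX.1.1.isSide.2⟩
    rw [hX.1.boundary_eq] at this
    omega
  | succ j ih =>
    intro S hv hS hlarge
    by_cases hex : ∃ A, IsSide G W S A ∧ (boundary G A).card ≤ k
    swap
    · push Not at hex
      refine ⟨∅, by simp, by simp, fun X hX hk hSX => ?_⟩
      have := hex _ ⟨hSX, hX.1.1.isSide.2⟩
      rw [hX.1.boundary_eq] at this
      omega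
    obtain ⟨A, hA, hAk⟩ := hex
    obtain ⟨M, hM⟩ := hA.exists_isFurthest
    have hSM : S ⊆ component G M v := hS.trans (component_mono G hM.1.1 v)
    -- The boundary of `M` is itself an important separator of size at most `k`, so it is not
    -- contained in `Y`.
    obtain ⟨x, hxM, hxY⟩ := Finset.not_subset.1
      (hY _ (hM.isImportantSeparator hv hSM) ((hM.2 A hA).1.trans hAk))
    have hvM : v ∈ component G M v := hSM hv
    obtain ⟨H, hH, hHY, hhit⟩ := ih (insert x (component G M v)) (by simp [hvM]) (by
        have hsub : component G M v ⊆ component G (insert x (component G M v)) v := by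
          conv_lhs => rw [← component_component G M v]
          exact component_mono G (Finset.subset_insert _ _) v
        rw [Finset.insert_subset_iff]
        refine ⟨?_, hsub⟩
        rw [← hM.boundary_component hSM] at hxM
        obtain ⟨-, y, hy, hxy⟩ := mem_boundary.1 hxM
        exact component_step (hsub hy) hxy (Finset.mem_insert_self _ _)) (by
        -- A side of the new sources contains `x`, which is not in `M`. As `M` contains every side
        -- of smallest boundary, the boundary of `B` is strictly larger, which pays for the decrease
        -- of `j`.
        intro B hB
        have h1 := hlarge M hM.1
        have hBS : IsSide G W S B := hB.mono (hSM.trans (Finset.subset_insert _ _))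
        by_contra hle
        exact (mem_boundary.1 hxM).1
          ((hM.2 B hBS).2 (by omega) (hB.1 (Finset.mem_insert_self _ _))))
    refine ⟨insert x H, (Finset.card_insert_le _ _).trans (by omega), ?_, fun X hX hk hSX => ?_⟩
    · rw [Finset.disjoint_insert_left]
      exact ⟨hxY, hHY⟩
    · rw [Finset.disjoint_insert_right]
      rintro ⟨hxX, hXH⟩
      refine hhit X hX hk (Finset.insert_subset_iff.2 ⟨?_, ?_⟩) hXH
      · have := hX.boundary_furthest_subset hv hSX hM hSM hxM
        simpa [hxX] using this
      · exact hX.component_minimum_subset hv hSX hM.1 fun A hA => (hM.2 A hA).1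

/-- If no important separator of size at most `k` is contained in `Y`, then `k + 1` vertices
outside `Y` hit all of them. -/
theorem exists_hitting_set (G : SimpleGraph V) (W Y : Finset V) (k : ℕ) (v : V)
    (hY : ∀ X, IsImportantSeparator G {v} W X → X.card ≤ k → ¬ X ⊆ Y) :
    ∃ H : Finset V, H.card ≤ k + 1 ∧ Disjoint H Y ∧
      ∀ X, IsImportantSeparator G {v} W X → X.card ≤ k → ¬ Disjoint X H := by
  obtain ⟨H, h1, h2, h3⟩ := exists_hitting_set_aux G W Y k v hY (k + 1) {v} (by simp)
    (by simpa using self_mem_component (Finset.mem_singleton_self v)) (fun A _ => by omega)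
  exact ⟨H, h1, h2, fun X hX hk => h3 X hX hk hX.1.1.isSide.1⟩

end Boundary

/-! ## Residual capacities -/

section Capacity

open Classical in
/-- The total capacity of the arcs that leave `B`, for a capacity matrix `r` on `0, …, N - 1`. -/
noncomputable def capacity (N : ℕ) (r : ℕ → ℕ → ℕ) (B : Set ℕ) : ℕ :=
  ∑ a ∈ Finset.range N, ∑ b ∈ Finset.range N, if a ∈ B ∧ b ∉ B then r a b else 0

/-- Push one unit along the arc `(a, b)`. -/
def pushArc (r : ℕ → ℕ → ℕ) (a b : ℕ) : ℕ → ℕ → ℕ := fun x y =>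
  if x = a ∧ y = b then r a b - 1 else if x = b ∧ y = a then r b a + 1 else r x y

theorem capacity_add_single (N : ℕ) (r r' : ℕ → ℕ → ℕ) (B : Set ℕ) {a b : ℕ} (ha : a < N)
    (hb : b < N) [Decidable (a ∈ B ∧ b ∉ B)]
    (h : ∀ x y, r' x y = r x y + if x = a ∧ y = b then 1 else 0) :
    capacity N r' B = capacity N r B + if a ∈ B ∧ b ∉ B then 1 else 0 := by
  classical
  have h1 : ∀ x y, (if x ∈ B ∧ y ∉ B then r' x y else 0) =
      (if x ∈ B ∧ y ∉ B then r x y else 0) +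
        if x = a then (if y = b then (if a ∈ B ∧ b ∉ B then 1 else 0) else 0) else 0 := by
    intro x y
    rw [h]
    by_cases hx : x = a <;> by_cases hy : y = b <;> simp [hx, hy]
    split_ifs <;> simp
  unfold capacity
  simp only [h1, Finset.sum_add_distrib]
  congr 1
  rw [Finset.sum_eq_single a, Finset.sum_eq_single b]
  · simp
  · intro y _ hy; simp [hy]
  · intro hb'; exact absurd (Finset.mem_range.2 hb) hb'
  · intro x _ hx; simp [hx]
  · intro ha'; exact absurd (Finset.mem_range.2 ha) ha'

-- The change of the cut depends only on the ends of the arc, so pushes along a path telescope. The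
-- proof compares both matrices with a third one, in which the reverse arc has gained its unit and
-- the forward arc has not lost it.
open Classical in
theorem capacity_pushArc (N : ℕ) (r : ℕ → ℕ → ℕ) (B : Set ℕ) {a b : ℕ} (ha : a < N)
    (hb : b < N) (hab : a ≠ b) (hr : r a b ≠ 0) :
    capacity N (pushArc r a b) B + (if a ∈ B then 1 else 0) =
      capacity N r B + if b ∈ B then 1 else 0 := by
  have h1 := capacity_add_single N (pushArc r a b)
    (fun x y => pushArc r a b x y + if x = a ∧ y = b then 1 else 0) B ha hb fun x y => rfl
  have h2 := capacity_add_single N r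
    (fun x y => pushArc r a b x y + if x = a ∧ y = b then 1 else 0) B hb ha fun x y => by
      simp only [pushArc]
      by_cases h : x = a ∧ y = b
      · obtain ⟨rfl, rfl⟩ := h
        have : ¬ (x = y ∧ y = x) := fun h => hab h.1
        simp [this]
        omega
      · rw [if_neg h, if_neg h]
        by_cases h' : x = b ∧ y = a
        · obtain ⟨rfl, rfl⟩ := h'
          simp
        · simp [h']
  rw [h1] at h2
  by_cases hA : a ∈ B <;> by_cases hB : b ∈ B <;> simp_all

/-- No arc of positive capacity leaves `B`. -/
def NoArcLeaves (N : ℕ) (r : ℕ → ℕ → ℕ) (B : Set ℕ) : Prop :=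
  ∀ a < N, ∀ b < N, a ∈ B → b ∉ B → r a b = 0

theorem capacity_eq_zero_iff {N : ℕ} {r : ℕ → ℕ → ℕ} {B : Set ℕ} :
    capacity N r B = 0 ↔ NoArcLeaves N r B := by
  classical
  unfold capacity NoArcLeaves
  simp only [Finset.sum_eq_zero_iff, Finset.mem_range]
  refine forall₂_congr fun a _ => forall₂_congr fun b _ => ?_
  by_cases h1 : a ∈ B <;> by_cases h2 : b ∈ B <;> simp [h1, h2]

/-! ### Rankings and augmentations -/

/-- Search labels for the nodes that reach `T`: a node has nonzero rank if it reaches `T`, and every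
ranked node outside `T` has an arc of positive capacity to the ranked node `nxt a` of smaller
rank. -/
structure IsRanking (N : ℕ) (r : ℕ → ℕ → ℕ) (T : Set ℕ) (rank nxt : ℕ → ℕ) : Prop where
  sink : ∀ a ∈ T, rank a = 1
  step : ∀ a < N, rank a ≠ 0 → a ∈ T ∨
    nxt a < N ∧ rank (nxt a) ≠ 0 ∧ rank (nxt a) < rank a ∧ r a (nxt a) ≠ 0
  one_lt : ∀ a < N, a ∉ T → rank a ≠ 0 → 1 < rank a
  closed : ∀ a < N, ∀ b < N, rank b ≠ 0 → r a b ≠ 0 → rank a ≠ 0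

/-- From a ranked node of `K`, the successors have decreasing ranks and never leave `K`, so they
would end in `T`. Hence the unranked nodes form the largest closed set that avoids `T`, which is
what makes the resulting cut the furthest one. -/
theorem IsRanking.rank_eq_zero {N : ℕ} {r : ℕ → ℕ → ℕ} {T : Set ℕ} {rank nxt : ℕ → ℕ}
    (h : IsRanking N r T rank nxt) {K : Set ℕ} (hK : NoArcLeaves N r K) (hKT : Disjoint K T) :
    ∀ a < N, a ∈ K → rank a = 0 := by
  have : ∀ m a, rank a = m → a < N → a ∈ K → rank a = 0 := by
    intro m
    induction m using Nat.strong_induction_on with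
    | _ m ih =>
      intro a ham ha haK
      by_contra h0
      rcases h.step a ha h0 with hT | ⟨h1, h2, h3, h4⟩
      · exact Set.disjoint_left.1 hKT haK hT
      · by_cases hn : nxt a ∈ K
        · exact h2 (ih _ (ham ▸ h3) _ rfl h1 hn)
        · exact h4 (hK a ha _ h1 haK hn)
  exact fun a ha haK => this _ a rfl ha haK

/-- `r'` arises from `r` by pushing one unit from `S` to `T` through ranked nodes. -/
structure IsAugmentation (N : ℕ) (r r' : ℕ → ℕ → ℕ) (S T : Set ℕ) (rank : ℕ → ℕ) : Prop where
  capacity : ∀ B, S ⊆ B → Disjoint B T → capacity N r' B + 1 = capacity N r B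
  same : ∀ a b, rank a = 0 → r' a b = r a b

open Classical in
/-- A partial augmentation: one unit has been pushed from `start` to `tok`. -/
structure IsPartialPush (N : ℕ) (r r' : ℕ → ℕ → ℕ) (rank nxt : ℕ → ℕ) (start tok : ℕ) : Prop where
  lt : tok < N
  rank_ne : rank tok ≠ 0
  capacity : ∀ B, capacity N r' B + (if start ∈ B then 1 else 0) =
    capacity N r B + if tok ∈ B then 1 else 0
  same : ∀ a b, rank a = 0 → r' a b = r a b
  ahead : ∀ a, rank a ≤ rank tok → r a (nxt a) ≠ 0 → r' a (nxt a) ≠ 0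

theorem IsPartialPush.refl {N : ℕ} {r : ℕ → ℕ → ℕ} {rank nxt : ℕ → ℕ} {start : ℕ}
    (h : start < N) (h0 : rank start ≠ 0) : IsPartialPush N r r rank nxt start start :=
  ⟨h, h0, fun _ => rfl, fun _ _ _ => rfl, fun _ _ h => h⟩

/-- Ranks decrease along the path, so no arc ahead of the unit has been used yet: its capacity is
still positive in the modified matrix, although the ranking was computed for the original one. -/
theorem IsPartialPush.step {N : ℕ} {r r' : ℕ → ℕ → ℕ} {rank nxt : ℕ → ℕ} {T : Set ℕ}
    {start tok : ℕ} (hR : IsRanking N r T rank nxt)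
    (h : IsPartialPush N r r' rank nxt start tok) (hT : 1 < rank tok) :
    IsPartialPush N r (pushArc r' tok (nxt tok)) rank nxt start (nxt tok) ∧
      rank (nxt tok) < rank tok := by
  have hT' : tok ∉ T := fun h' => by have := hR.sink _ h'; omega
  obtain ⟨h1, h2, h3, h4⟩ := (hR.step tok h.lt h.rank_ne).resolve_left hT'
  have hne : tok ≠ nxt tok := fun he => by rw [← he] at h3; omega
  refine ⟨⟨h1, h2, fun B => ?_, fun a b ha => ?_, fun a ha hra => ?_⟩, h3⟩
  · have e1 := capacity_pushArc N r' B h.lt h1 hne (h.ahead tok le_rfl h4)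
    have e2 := h.capacity B
    omega
  · have ha1 : a ≠ tok := fun he => h.rank_ne (he ▸ ha)
    have ha2 : a ≠ nxt tok := fun he => h2 (he ▸ ha)
    simp [pushArc, ha1, ha2, h.same a b ha]
  · have ha1 : a ≠ tok := fun he => by subst he; omega
    have h5 := h.ahead a (by omega) hra
    unfold pushArc
    rw [if_neg (by simp [ha1])]
    split_ifs
    · omega
    · exact h5

theorem IsPartialPush.isAugmentation {N : ℕ} {r r' : ℕ → ℕ → ℕ} {rank nxt : ℕ → ℕ} {S T : Set ℕ}
    {start tok : ℕ} (hR : IsRanking N r T rank nxt)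
    (h : IsPartialPush N r r' rank nxt start tok) (hS : start ∈ S) (hT : rank tok ≤ 1) :
    IsAugmentation N r r' S T rank := by
  have htok : tok ∈ T := by
    by_contra hT'
    have := hR.one_lt tok h.lt hT' h.rank_ne
    omega
  refine ⟨fun B hSB hBT => ?_, h.same⟩
  have := h.capacity B
  rwa [if_pos (hSB hS), if_neg fun hB => Set.disjoint_left.1 hBT hB htok] at this

end Capacity

/-! ## The split digraph of a graph -/

section Split

variable {n : ℕ}

/-- Adjacency on natural numbers. -/
def NatAdj (G : SimpleGraph (Fin n)) (a b : ℕ) : Prop :=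
  ∃ i j : Fin n, a = i ∧ b = j ∧ G.Adj i j

open Classical in
/-- The split digraph: the node `x` and the node `n + x` are the two halves of the vertex `x`, the
first joined to the second by an arc of capacity `1`. Edges have capacity `k + 1`. -/
noncomputable def splitCapacity (G : SimpleGraph (Fin n)) (k a b : ℕ) : ℕ :=
  if a < n then (if b = n + a then 1 else 0)
  else if NatAdj G (a - n) b then k + 1 else 0

/-- The out-halves of the vertices in `S`. -/
def outNodes (S : Finset (Fin n)) : Set ℕ := {a | ∃ x ∈ S, a = n + x.val}

/-- Both halves of the vertices in `W`. -/
def bothNodes (W : Finset (Fin n)) : Set ℕ := {a | ∃ x ∈ W, a = x.val ∨ a = n + x.val}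

/-- The vertices whose out-half is in `B`. -/
noncomputable def outSide (n : ℕ) (B : Set ℕ) : Finset (Fin n) := by
  classical exact Finset.univ.filter fun x => n + x.val ∈ B

/-- The vertices cut by `B`. -/
noncomputable def cutVertices (n : ℕ) (B : Set ℕ) : Finset (Fin n) := by
  classical exact Finset.univ.filter fun x => x.val ∈ B ∧ n + x.val ∉ B

/-- The node set that corresponds to the side `A`. -/
def sideNodes (G : SimpleGraph (Fin n)) (A : Finset (Fin n)) : Set ℕ :=
  {a | ∃ x : Fin n, (a = x.val ∧ (x ∈ A ∨ x ∈ boundary G A)) ∨ (a = n + x.val ∧ x ∈ A)}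

theorem mem_outSide {B : Set ℕ} {x : Fin n} : x ∈ outSide n B ↔ n + x.val ∈ B := by
  simp [outSide]

theorem mem_cutVertices {B : Set ℕ} {x : Fin n} :
    x ∈ cutVertices n B ↔ x.val ∈ B ∧ n + x.val ∉ B := by
  simp [cutVertices]

theorem in_mem_sideNodes {G : SimpleGraph (Fin n)} {A : Finset (Fin n)} {x : Fin n} :
    x.val ∈ sideNodes G A ↔ x ∈ A ∨ x ∈ boundary G A := by
  constructor
  · rintro ⟨y, ⟨h, h'⟩ | ⟨h, -⟩⟩
    · rwa [Fin.ext h]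
    · have := x.isLt; omega
  · exact fun h => ⟨x, Or.inl ⟨rfl, h⟩⟩

theorem out_mem_sideNodes {G : SimpleGraph (Fin n)} {A : Finset (Fin n)} {x : Fin n} :
    n + x.val ∈ sideNodes G A ↔ x ∈ A := by
  constructor
  · rintro ⟨y, ⟨h, -⟩ | ⟨h, h'⟩⟩
    · have := y.isLt; omega
    · rwa [Fin.ext (by omega : x.val = y.val)]
  · exact fun h => ⟨x, Or.inr ⟨rfl, h⟩⟩

theorem natAdj_fin {G : SimpleGraph (Fin n)} {x y : Fin n} : NatAdj G x y ↔ G.Adj x y := by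
  constructor
  · rintro ⟨i, j, hi, hj, h⟩
    rwa [Fin.ext hi, Fin.ext hj]
  · exact fun h => ⟨x, y, rfl, rfl, h⟩

-- Of the four blocks of the matrix only two are nonzero: in-half to out-half gives the cut
-- vertices, out-half to in-half gives the cut edges.
open Classical in
theorem capacity_split (G : SimpleGraph (Fin n)) (k : ℕ) (B : Set ℕ) :
    capacity (2 * n) (splitCapacity G k) B = (cutVertices n B).card +
      ∑ x : Fin n, ∑ y : Fin n,
        if n + x.val ∈ B ∧ y.val ∉ B ∧ G.Adj x y then k + 1 else 0 := by
  have hsplit : ∀ f : ℕ → ℕ, ∑ a ∈ Finset.range (2 * n), f a =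
      ∑ x : Fin n, f x + ∑ x : Fin n, f (n + x) := by
    intro f
    rw [two_mul, Finset.sum_range_add, Finset.sum_range, Finset.sum_range]
  unfold capacity
  rw [hsplit]
  congr 1
  · rw [cutVertices, Finset.card_filter]
    refine Finset.sum_congr rfl fun x _ => ?_
    rw [hsplit, Finset.sum_eq_zero, zero_add, Finset.sum_eq_single x]
    · simp [splitCapacity]
    · intro y _ hy
      have : ¬ (n + y.val = n + x.val) := fun h => hy (Fin.ext (by omega))
      simp only [splitCapacity, if_pos x.isLt, if_neg this, ite_self]
    · simp
    · intro y _
      have : ¬ (y.val = n + x.val) := by have := y.isLt; omega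
      simp only [splitCapacity, if_pos x.isLt, if_neg this, ite_self]
  · refine Finset.sum_congr rfl fun x _ => ?_
    rw [hsplit, Finset.sum_eq_zero (s := Finset.univ) (f := fun y : Fin n =>
      if n + x.val ∈ B ∧ n + y.val ∉ B then splitCapacity G k (n + x) (n + y) else 0), add_zero]
    · refine Finset.sum_congr rfl fun y _ => ?_
      simp only [splitCapacity, Nat.add_sub_cancel_left, natAdj_fin,
        if_neg (by omega : ¬ n + x.val < n)]
      by_cases h1 : n + x.val ∈ B <;> by_cases h2 : y.val ∈ B <;> simp [h1, h2]
    · intro y _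
      have : ¬ NatAdj G (n + x.val - n) (n + y.val) := by
        rintro ⟨i, j, -, h, -⟩
        have := j.isLt
        omega
      simp only [splitCapacity, if_neg this, if_neg (by omega : ¬ n + x.val < n), ite_self]

theorem capacity_sideNodes (G : SimpleGraph (Fin n)) (k : ℕ) (A : Finset (Fin n)) :
    capacity (2 * n) (splitCapacity G k) (sideNodes G A) = (boundary G A).card := by
  classical
  rw [capacity_split, Finset.sum_eq_zero, add_zero]
  · congr 1
    ext x
    rw [mem_cutVertices, in_mem_sideNodes, out_mem_sideNodes]
    have : x ∈ boundary G A → x ∉ A := fun h => (mem_boundary.1 h).1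
    tauto
  · intro x _
    refine Finset.sum_eq_zero fun y _ => if_neg ?_
    rw [in_mem_sideNodes, out_mem_sideNodes]
    rintro ⟨h1, h2, h3⟩
    exact h2 (by by_cases hy : y ∈ A <;> simp [hy, mem_boundary]; exact ⟨x, h1, h3⟩)

/-- An edge costs `k + 1`, so a cut of capacity at most `k` cuts vertices only. -/
theorem adj_mem_of_capacity_le {G : SimpleGraph (Fin n)} {k : ℕ} {B : Set ℕ}
    (h : capacity (2 * n) (splitCapacity G k) B ≤ k) {x y : Fin n} (hx : n + x.val ∈ B)
    (hxy : G.Adj x y) : y.val ∈ B := by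
  classical
  by_contra hy
  rw [capacity_split] at h
  have h1 := Finset.single_le_sum (f := fun y : Fin n =>
    if n + x.val ∈ B ∧ y.val ∉ B ∧ G.Adj x y then k + 1 else 0)
    (fun _ _ => Nat.zero_le _) (Finset.mem_univ y)
  have h2 := Finset.single_le_sum (f := fun x : Fin n => ∑ y : Fin n,
    if n + x.val ∈ B ∧ y.val ∉ B ∧ G.Adj x y then k + 1 else 0)
    (fun _ _ => Nat.zero_le _) (Finset.mem_univ x)
  simp only [hx, hy, hxy, not_false_eq_true, and_self, if_true] at h1
  simp only [hx] at h2 h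
  simp only [true_and] at h1 h2
  omega

theorem card_cutVertices_le (G : SimpleGraph (Fin n)) (k : ℕ) (B : Set ℕ) :
    (cutVertices n B).card ≤ capacity (2 * n) (splitCapacity G k) B := by
  classical
  rw [capacity_split]
  exact Nat.le_add_right _ _

theorem boundary_outSide_subset {G : SimpleGraph (Fin n)} {k : ℕ} {B : Set ℕ}
    (h : capacity (2 * n) (splitCapacity G k) B ≤ k) :
    boundary G (outSide n B) ⊆ cutVertices n B := by
  intro x hx
  obtain ⟨h1, y, hy, hxy⟩ := mem_boundary.1 hx
  rw [mem_outSide] at h1 hy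
  exact mem_cutVertices.2 ⟨adj_mem_of_capacity_le h hy hxy, h1⟩

end Split

/-! ## Searching for an important separator inside a set -/

section Search

variable {n : ℕ}

/-- Invariant of the search for an important `{v}`-`W` separator of size at most `k` inside `U`:
`S` is the current set of sources, and `m` units have been pushed from `S` to `W`. -/
structure SearchInv (G : SimpleGraph (Fin n)) (k : ℕ) (W U : Finset (Fin n)) (v : Fin n)
    (S : Finset (Fin n)) (r : ℕ → ℕ → ℕ) (m : ℕ) : Prop where
  mem : v ∈ S
  capacity : ∀ B, outNodes S ⊆ B → Disjoint B (bothNodes W) →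
    capacity (2 * n) r B + m = capacity (2 * n) (splitCapacity G k) B
  connected : ∃ K, Disjoint K (bothNodes W) ∧ NoArcLeaves (2 * n) r K ∧
    S ⊆ component G (outSide n K ∪ S) v
  below : ∀ X, IsImportantSeparator G {v} W X → X.card ≤ k → X ⊆ U → S ⊆ component G Xᶜ v

theorem SearchInv.init (G : SimpleGraph (Fin n)) (k : ℕ) (W U : Finset (Fin n)) (v : Fin n) :
    SearchInv G k W U v {v} (splitCapacity G k) 0 where
  mem := Finset.mem_singleton_self v
  capacity _ _ _ := rfl
  connected := ⟨∅, by simp, fun _ _ _ _ h => h.elim, by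
    rw [Finset.singleton_subset_iff]; exact self_mem_component (by simp)⟩
  below X hX _ _ := hX.1.1.isSide.1

variable {G : SimpleGraph (Fin n)} {k : ℕ} {W U : Finset (Fin n)} {v : Fin n}
  {S : Finset (Fin n)} {r r' : ℕ → ℕ → ℕ} {m : ℕ} {rank nxt : ℕ → ℕ}

theorem outNodes_subset_sideNodes {A : Finset (Fin n)} (h : S ⊆ A) :
    outNodes S ⊆ sideNodes G A := by
  rintro _ ⟨x, hx, rfl⟩
  exact out_mem_sideNodes.2 (h hx)

theorem IsSide.disjoint_bothNodes {A : Finset (Fin n)} (h : IsSide G W S A) :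
    Disjoint (sideNodes G A) (bothNodes W) := by
  rw [Set.disjoint_left]
  rintro _ ha ⟨x, hx, rfl | rfl⟩
  · rw [in_mem_sideNodes] at ha
    exact ha.elim (fun h' => Finset.disjoint_left.1 h.2.1 h' hx)
      fun h' => Finset.disjoint_left.1 h.2.2 h' hx
  · exact Finset.disjoint_left.1 h.2.1 (out_mem_sideNodes.1 ha) hx

theorem SearchInv.capacity_sideNodes (h : SearchInv G k W U v S r m) {A : Finset (Fin n)}
    (hA : IsSide G W S A) : ShadowRemoval.capacity (2 * n) r (sideNodes G A) + m =
      (boundary G A).card := by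
  rw [h.capacity _ (outNodes_subset_sideNodes hA.1) hA.disjoint_bothNodes,
    ShadowRemoval.capacity_sideNodes]

/-- The source side of the separator is a cut of value at most `k`, which bounds the flow. A flow
beyond `k` therefore allows the search to stop with a negative answer. -/
theorem SearchInv.le_of_exists (h : SearchInv G k W U v S r m)
    (hX : ∃ X, IsImportantSeparator G {v} W X ∧ X.card ≤ k ∧ X ⊆ U) : m ≤ k := by
  obtain ⟨X, h1, h2, h3⟩ := hX
  have := h.capacity_sideNodes ⟨h.below X h1 h2 h3, h1.1.1.isSide.2⟩
  rw [h1.1.boundary_eq] at this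
  omega

/-- Connectedness survives because the set `K` contains no ranked node, and an augmentation changes
only arcs that start at ranked nodes. -/
theorem SearchInv.augment (h : SearchInv G k W U v S r m)
    (hR : IsRanking (2 * n) r (bothNodes W) rank nxt)
    (ha : IsAugmentation (2 * n) r r' (outNodes S) (bothNodes W) rank) :
    SearchInv G k W U v S r' (m + 1) where
  mem := h.mem
  capacity B hB hBT := by
    have h1 := ha.capacity B hB hBT
    have h2 := h.capacity B hB hBT
    omega
  connected := by
    obtain ⟨K, h1, h2, h3⟩ := h.connected
    refine ⟨K, h1, fun a haN b hbN haK hbK => ?_, h3⟩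
    rw [ha.same a b (hR.rank_eq_zero h2 h1 a haN haK)]
    exact h2 a haN b hbN haK hbK
  below := h.below

theorem IsRanking.noArcLeaves {N : ℕ} {T : Set ℕ} (h : IsRanking N r T rank nxt) :
    NoArcLeaves N r {a | rank a = 0} := by
  intro a ha b hb h1 h2
  by_contra h3
  exact h.closed a ha b hb h2 h3 h1

theorem IsRanking.disjoint {N : ℕ} {T : Set ℕ} (h : IsRanking N r T rank nxt) :
    Disjoint {a | rank a = 0} T := by
  rw [Set.disjoint_left]
  intro a h1 h2
  have := h.sink a h2
  simp only [Set.mem_ofPred_eq] at h1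
  omega

/-- If no source is ranked, the unranked nodes form the furthest minimum cut. -/
theorem SearchInv.saturated (h : SearchInv G k W U v S r m) (hm : m ≤ k)
    (hR : IsRanking (2 * n) r (bothNodes W) rank nxt) (hS : ∀ x ∈ S, rank (n + x.val) = 0) :
    IsFurthest G W S (outSide n {a | rank a = 0}) ∧
    S ⊆ component G (outSide n {a | rank a = 0}) v ∧
    boundary G (outSide n {a | rank a = 0}) = cutVertices n {a | rank a = 0} ∧
    (boundary G (outSide n {a | rank a = 0})).card ≤ k := by
  have hSK : outNodes S ⊆ {a | rank a = 0} := by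
    rintro _ ⟨x, hx, rfl⟩
    exact hS x hx
  have hcap := h.capacity _ hSK hR.disjoint
  rw [capacity_eq_zero_iff.2 hR.noArcLeaves, zero_add] at hcap
  have hcut := card_cutVertices_le G k {a | rank a = 0}
  have hbd := boundary_outSide_subset (G := G) (k := k) (B := {a | rank a = 0}) (by omega)
  have hbd' := Finset.card_le_card hbd
  have hSM : S ⊆ outSide n {a | rank a = 0} := fun x hx => mem_outSide.2 (hS x hx)
  have hside : IsSide G W S (outSide n {a | rank a = 0}) := by
    refine ⟨hSM, ?_, Finset.disjoint_of_subset_left hbd ?_⟩ <;> rw [Finset.disjoint_left] <;>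
      intro x hx hW
    · exact Set.disjoint_left.1 hR.disjoint (mem_outSide.1 hx) ⟨x, hW, Or.inr rfl⟩
    · exact Set.disjoint_left.1 hR.disjoint (mem_cutVertices.1 hx).1 ⟨x, hW, Or.inl rfl⟩
  -- The cut by the unranked nodes has capacity `m` and contains the boundary, while every side has
  -- a boundary of size at least `m`; so the boundary is the whole set of cut vertices and is
  -- minimum.
  have hmle := h.capacity_sideNodes hside
  refine ⟨⟨hside, fun A hA => ?_⟩, ?_, Finset.eq_of_subset_of_card_le hbd (by omega), by omega⟩
  · have h1 := h.capacity_sideNodes hA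
    refine ⟨by omega, fun hle x hx => ?_⟩
    -- Another side of minimum boundary has residual capacity zero, so it contains no ranked node
    -- and lies inside the set of unranked ones.
    have h2 : ShadowRemoval.capacity (2 * n) r (sideNodes G A) = 0 := by omega
    exact mem_outSide.2 (hR.rank_eq_zero (capacity_eq_zero_iff.1 h2) hA.disjoint_bothNodes _
      (by have := x.isLt; omega) (out_mem_sideNodes.2 hx))
  · obtain ⟨K, h1, h2, h3⟩ := h.connected
    refine h3.trans (component_mono G (Finset.union_subset (fun x hx => ?_) hSM) v)
    exact mem_outSide.2 (hR.rank_eq_zero h2 h1 _ (by have := x.isLt; omega) (mem_outSide.1 hx))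

/-- A separator inside `U` cannot contain a cut vertex outside `U`, so that vertex lies on its
source side. The flow is kept: with more sources, its capacity equation is required for fewer cuts.
-/
theorem SearchInv.enlarge (h : SearchInv G k W U v S r m) (hm : m ≤ k)
    (hR : IsRanking (2 * n) r (bothNodes W) rank nxt) (hS : ∀ x ∈ S, rank (n + x.val) = 0) :
    SearchInv G k W U v (S ∪ (cutVertices n {a | rank a = 0} \ U)) r m := by
  obtain ⟨hF, hSM, hcut, -⟩ := h.saturated hm hR hS
  rw [← hcut]
  refine ⟨Finset.mem_union_left _ h.mem, fun B hB hBT => h.capacity B (fun a ha => hB ?_) hBT,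
    ⟨_, hR.disjoint, hR.noArcLeaves, ?_⟩, fun X hX hXk hXU => ?_⟩
  · obtain ⟨x, hx, rfl⟩ := ha
    exact ⟨x, Finset.mem_union_left _ hx, rfl⟩
  · have hsub := component_mono G (Finset.subset_union_left (s₁ := outSide n {a | rank a = 0})
      (s₂ := S ∪ (boundary G (outSide n {a | rank a = 0}) \ U))) v
    refine Finset.union_subset (hSM.trans hsub) fun x hx => ?_
    have hx' := (Finset.mem_sdiff.1 hx).1
    rw [← hF.boundary_component hSM] at hx'
    obtain ⟨-, y, hy, hxy⟩ := mem_boundary.1 hx'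
    exact component_step (hsub hy) hxy (by simp only [Finset.mem_union]; exact Or.inr (Or.inr hx))
  · refine Finset.union_subset (h.below X hX hXk hXU) fun x hx => ?_
    obtain ⟨hx1, hx2⟩ := Finset.mem_sdiff.1 hx
    exact (Finset.mem_union.1 (hX.boundary_furthest_subset h.mem (h.below X hX hXk hXU) hF hSM
      hx1)).resolve_right fun h' => hx2 (hXU h')

theorem SearchInv.exists_of_subset (h : SearchInv G k W U v S r m) (hm : m ≤ k)
    (hR : IsRanking (2 * n) r (bothNodes W) rank nxt) (hS : ∀ x ∈ S, rank (n + x.val) = 0)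
    (hU : cutVertices n {a | rank a = 0} ⊆ U) :
    ∃ X, IsImportantSeparator G {v} W X ∧ X.card ≤ k ∧ X ⊆ U := by
  obtain ⟨hF, hSM, hcut, hk⟩ := h.saturated hm hR hS
  exact ⟨_, hF.isImportantSeparator h.mem hSM, hk, hcut ▸ hU⟩

end Search

/-! ## Total correctness of programs whose loops are short -/

section Runs

/-- A bound for the running time of a program each of whose loops makes at most `B` rounds. -/
def Prog.time (B : ℕ) : Prog → ℕ
  | .skip => 1
  | .assign _ e => e.cost + 1
  | .put _ i e => i.cost + e.cost + 1
  | .flip _ => 1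
  | .seq p q => p.time B + q.time B
  | .ite e p q => e.cost + 1 + (p.time B + q.time B)
  | .loop e p => (B + 1) * (e.cost + 1 + p.time B)

/-- A fixed program has fixed nesting depth, so its time is polynomial in the loop bound. A single
constant serves as factor and exponent, which keeps the induction uniform. -/
theorem Prog.exists_time_le (p : Prog) : ∃ c, ∀ B, p.time B ≤ c * (B + 1) ^ c := by
  have mono : ∀ c d B : ℕ, c ≤ d → c * (B + 1) ^ c ≤ d * (B + 1) ^ d := fun c d B h =>
    Nat.mul_le_mul h (Nat.pow_le_pow_right (Nat.succ_pos B) h)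
  have const : ∀ c B : ℕ, c ≤ c * (B + 1) ^ c := fun c B =>
    Nat.le_mul_of_pos_right _ (Nat.pow_pos (Nat.succ_pos B))
  have sum : ∀ a c d B x y : ℕ, x ≤ c * (B + 1) ^ c → y ≤ d * (B + 1) ^ d →
      a + (x + y) ≤ (a + c + d) * (B + 1) ^ (a + c + d) := by
    intro a c d B x y hx hy
    have h1 := hx.trans (Nat.mul_le_mul_left c (Nat.pow_le_pow_right (Nat.succ_pos B)
      (by omega : c ≤ a + c + d)))
    have h2 := hy.trans (Nat.mul_le_mul_left d (Nat.pow_le_pow_right (Nat.succ_pos B)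
      (by omega : d ≤ a + c + d)))
    have h3 : a ≤ a * (B + 1) ^ (a + c + d) :=
      Nat.le_mul_of_pos_right _ (Nat.pow_pos (Nat.succ_pos B))
    calc a + (x + y) ≤ a * (B + 1) ^ (a + c + d) +
          (c * (B + 1) ^ (a + c + d) + d * (B + 1) ^ (a + c + d)) :=
          Nat.add_le_add h3 (Nat.add_le_add h1 h2)
      _ = _ := by ring
  induction p with
  | skip => exact ⟨1, fun B => const 1 B⟩
  | assign x e => exact ⟨_, fun B => const (e.cost + 1) B⟩
  | put a i e => exact ⟨_, fun B => const (i.cost + e.cost + 1) B⟩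
  | flip x => exact ⟨1, fun B => const 1 B⟩
  | seq p q ihp ihq =>
    obtain ⟨c, hc⟩ := ihp
    obtain ⟨d, hd⟩ := ihq
    refine ⟨0 + c + d, fun B => ?_⟩
    have := sum 0 c d B _ _ (hc B) (hd B)
    rwa [Nat.zero_add] at this
  | ite e p q ihp ihq =>
    obtain ⟨c, hc⟩ := ihp
    obtain ⟨d, hd⟩ := ihq
    exact ⟨e.cost + 1 + c + d, fun B => sum _ c d B _ _ (hc B) (hd B)⟩
  | loop e p ih =>
    obtain ⟨c, hc⟩ := ih
    refine ⟨e.cost + 1 + c + 0 + 1, fun B => ?_⟩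
    have h := sum (e.cost + 1) c 0 B _ 0 (hc B) (Nat.zero_le _)
    rw [add_zero] at h
    calc (B + 1) * (e.cost + 1 + p.time B)
        ≤ (B + 1) * ((e.cost + 1 + c + 0) * (B + 1) ^ (e.cost + 1 + c + 0)) :=
          Nat.mul_le_mul_left _ h
      _ = (e.cost + 1 + c + 0) * (B + 1) ^ (e.cost + 1 + c + 0 + 1) := by ring
      _ ≤ _ := Nat.mul_le_mul_right _ (Nat.le_succ _)

/-! ### Frame conditions -/

/-- Whether a program assigns to register `x`. -/
def Prog.writesReg (x : ℕ) : Prog → Bool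
  | .skip => false
  | .assign y _ => x == y
  | .put _ _ _ => false
  | .flip y => x == y
  | .seq p q => p.writesReg x || q.writesReg x
  | .ite _ p q => p.writesReg x || q.writesReg x
  | .loop _ p => p.writesReg x

/-- Whether a program writes to array `a`. -/
def Prog.writesArr (a : ℕ) : Prog → Bool
  | .skip => false
  | .assign _ _ => false
  | .put b _ _ => a == b
  | .flip _ => false
  | .seq p q => p.writesArr a || q.writesArr a
  | .ite _ p q => p.writesArr a || q.writesArr a
  | .loop _ p => p.writesArr a

/-- Whether a program flips coins. -/
def Prog.flips : Prog → Bool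
  | .skip => false
  | .assign _ _ => false
  | .put _ _ _ => false
  | .flip _ => true
  | .seq p q => p.flips || q.flips
  | .ite _ p q => p.flips || q.flips
  | .loop _ p => p.flips

/-- What `p` never writes is the same in `s'` as in `s`. -/
structure Frame (p : Prog) (s s' : State) : Prop where
  reg : ∀ x, p.writesReg x = false → s'.reg x = s.reg x
  arr : ∀ a, p.writesArr a = false → s'.arr a = s.arr a
  coins : p.flips = false → s'.coins = s.coins

theorem Frame.refl (p : Prog) (s : State) : Frame p s s :=
  ⟨fun _ _ => rfl, fun _ _ => rfl, fun _ => rfl⟩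

theorem Frame.trans {p : Prog} {s s' s'' : State} (h : Frame p s s') (h' : Frame p s' s'') :
    Frame p s s'' :=
  ⟨fun x hx => (h'.reg x hx).trans (h.reg x hx), fun a ha => (h'.arr a ha).trans (h.arr a ha),
    fun hc => (h'.coins hc).trans (h.coins hc)⟩

theorem Frame.mono {p q : Prog} {s s' : State} (h : Frame p s s')
    (hr : ∀ x, q.writesReg x = false → p.writesReg x = false)
    (ha : ∀ x, q.writesArr x = false → p.writesArr x = false)
    (hf : q.flips = false → p.flips = false) : Frame q s s' :=
  ⟨fun x hx => h.reg x (hr x hx), fun a hx => h.arr a (ha a hx), fun hx => h.coins (hf hx)⟩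

/-- The side conditions are syntactic, so for a concrete program they hold by `rfl`, and
specifications need to mention only what changes. -/
theorem Exec.frame {ω : ℕ → Bool} {p : Prog} {s s' : State} {t : ℕ} (h : Exec ω p s s' t) :
    Frame p s s' := by
  induction h with
  | skip s => exact Frame.refl _ _
  | assign x e s =>
    refine ⟨fun y hy => ?_, fun _ _ => rfl, fun _ => rfl⟩
    simp only [Prog.writesReg, beq_eq_false_iff_ne] at hy
    simp [State.setReg, hy]
  | put a i e s =>
    refine ⟨fun _ _ => rfl, fun b hb => ?_, fun _ => rfl⟩
    simp only [Prog.writesArr, beq_eq_false_iff_ne] at hb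
    simp [State.setArr, hb]
  | flip x s =>
    refine ⟨fun y hy => ?_, fun _ _ => rfl, fun h => by simp [Prog.flips] at h⟩
    simp only [Prog.writesReg, beq_eq_false_iff_ne] at hy
    simp [State.setReg, hy]
  | seq _ _ h1 h2 =>
    refine (h1.mono ?_ ?_ ?_).trans (h2.mono ?_ ?_ ?_) <;>
      simp +contextual [Prog.writesReg, Prog.writesArr, Prog.flips]
  | iteTrue _ _ h1 =>
    refine h1.mono ?_ ?_ ?_ <;> simp +contextual [Prog.writesReg, Prog.writesArr, Prog.flips]
  | iteFalse _ _ h1 =>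
    refine h1.mono ?_ ?_ ?_ <;> simp +contextual [Prog.writesReg, Prog.writesArr, Prog.flips]
  | loopDone _ => exact Frame.refl _ _
  | loopStep _ _ _ h1 h2 =>
    exact Frame.trans (h1.mono (q := .loop _ _) (fun _ h => h) (fun _ h => h) fun h => h) h2

/-! ### Rules for total correctness -/

/-- `p` halts from `s` within `p.time B` steps in a state that satisfies `Q`. -/
def Runs (B : ℕ) (ω : ℕ → Bool) (p : Prog) (s : State) (Q : State → Prop) : Prop :=
  ∃ s' t, Exec ω p s s' t ∧ t ≤ p.time B ∧ Q s'

variable {B : ℕ} {ω : ℕ → Bool} {p q : Prog} {s : State} {Q Q' : State → Prop}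

theorem Runs.skip (h : Q s) : Runs B ω .skip s Q := ⟨_, _, .skip s, le_rfl, h⟩

theorem Runs.assign {x : ℕ} {e : Expr} (h : Q (s.setReg x (e.eval s))) :
    Runs B ω (.assign x e) s Q := ⟨_, _, .assign x e s, le_rfl, h⟩

theorem Runs.put {a : ℕ} {i e : Expr} (h : Q (s.setArr a (i.eval s) (e.eval s))) :
    Runs B ω (.put a i e) s Q := ⟨_, _, .put a i e s, le_rfl, h⟩

theorem Runs.flip {x : ℕ}
    (h : Q { s.setReg x (if ω s.coins = true then 1 else 0) with coins := s.coins + 1 }) :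
    Runs B ω (.flip x) s Q := ⟨_, _, .flip x s, le_rfl, h⟩

theorem Runs.seq (h : Runs B ω p s fun s' => Runs B ω q s' Q) : Runs B ω (.seq p q) s Q := by
  obtain ⟨s', t, h1, h2, s'', t', h3, h4, h5⟩ := h
  exact ⟨s'', _, .seq h1 h3, Nat.add_le_add h2 h4, h5⟩

theorem Runs.ite {e : Expr} (h1 : e.eval s ≠ 0 → Runs B ω p s Q)
    (h2 : e.eval s = 0 → Runs B ω q s Q) : Runs B ω (.ite e p q) s Q := by
  by_cases he : e.eval s = 0
  · obtain ⟨s', t, h3, h4, h5⟩ := h2 he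
    exact ⟨s', _, .iteFalse he h3, by simp only [Prog.time]; omega, h5⟩
  · obtain ⟨s', t, h3, h4, h5⟩ := h1 he
    exact ⟨s', _, .iteTrue he h3, by simp only [Prog.time]; omega, h5⟩

theorem Runs.mono (h : Runs B ω p s Q) (hQ : ∀ s', Frame p s s' → Q s' → Q' s') :
    Runs B ω p s Q' := by
  obtain ⟨s', t, h1, h2, h3⟩ := h
  exact ⟨s', t, h1, h2, hQ s' h1.frame h3⟩

/-- Run `p` with register `i` counting from `0` to the value of register `y`. -/
def forLoop (i y : ℕ) (p : Prog) : Prog :=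
  .seq (.assign i (.const 0))
    (.loop (.lt (.reg i) (.reg y)) (.seq p (.assign i (.add (.reg i) (.const 1)))))

@[simp] theorem setReg_reg (s : State) (x m y : ℕ) :
    (s.setReg x m).reg y = if y = x then m else s.reg y := by
  simp [State.setReg, Function.update_apply]

@[simp] theorem setReg_arr (s : State) (x m : ℕ) : (s.setReg x m).arr = s.arr := rfl

@[simp] theorem setReg_coins (s : State) (x m : ℕ) : (s.setReg x m).coins = s.coins := rfl

@[simp] theorem setArr_reg (s : State) (a i m : ℕ) : (s.setArr a i m).reg = s.reg := rfl

@[simp] theorem setArr_coins (s : State) (a i m : ℕ) : (s.setArr a i m).coins = s.coins := rfl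

@[simp] theorem setArr_arr (s : State) (a i m b j : ℕ) :
    (s.setArr a i m).arr b j = if b = a ∧ j = i then m else s.arr b j := by
  by_cases h : b = a
  · subst h; simp [State.setArr, Function.update_apply]
  · simp [State.setArr, h]

@[simp] theorem eval_const (s : State) (m : ℕ) : (Expr.const m).eval s = m := rfl

@[simp] theorem eval_reg (s : State) (x : ℕ) : (Expr.reg x).eval s = s.reg x := rfl

@[simp] theorem eval_get (s : State) (a : ℕ) (i : Expr) :
    (Expr.get a i).eval s = s.arr a (i.eval s) := rfl

@[simp] theorem eval_add (s : State) (e f : Expr) :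
    (Expr.add e f).eval s = e.eval s + f.eval s := rfl

@[simp] theorem eval_sub (s : State) (e f : Expr) :
    (Expr.sub e f).eval s = e.eval s - f.eval s := rfl

@[simp] theorem eval_lt_eq_zero (s : State) (e f : Expr) :
    (Expr.lt e f).eval s = 0 ↔ ¬ e.eval s < f.eval s := by
  simp only [Expr.eval]
  split_ifs with h <;> simp [h]

@[simp] theorem eval_eq_eq_zero (s : State) (e f : Expr) :
    (Expr.eq e f).eval s = 0 ↔ ¬ e.eval s = f.eval s := by
  simp only [Expr.eval]
  split_ifs with h <;> simp [h]

/-- As the body writes neither the counter nor the bound, the number of rounds is known on entry;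
termination and the time bound follow from the bound being at most `B`. -/
theorem Runs.for {i y : ℕ} (I : ℕ → State → Prop) (hi : p.writesReg i = false)
    (hy : p.writesReg y = false) (hiy : y ≠ i) (hB : s.reg y ≤ B) (h0 : I 0 (s.setReg i 0))
    (hstep : ∀ j s', j < s.reg y → Frame (forLoop i y p) s s' → s'.reg i = j → I j s' →
      Runs B ω p s' fun s'' => I (j + 1) (s''.setReg i (j + 1)))
    (hQ : ∀ s', Frame (forLoop i y p) s s' → s'.reg i = s.reg y → I (s.reg y) s' → Q s') :
    Runs B ω (forLoop i y p) s Q := by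
  have hi' : ∀ x, (forLoop i y p).writesReg x = false → x ≠ i ∧ p.writesReg x = false := by
    intro x hx
    simp only [forLoop, Prog.writesReg, Bool.or_eq_false_iff, beq_eq_false_iff_ne] at hx
    exact ⟨hx.1, hx.2.1⟩
  have hyf : (forLoop i y p).writesReg y = false := by
    simp [forLoop, Prog.writesReg, hy, hiy]
  -- Here `d` is the number of rounds left; the factor `d + 1` includes the final failing test.
  have key : ∀ d j s', j + d = s.reg y → Frame (forLoop i y p) s s' → s'.reg i = j → I j s' →
      ∃ s'' t, Exec ω (.loop (.lt (.reg i) (.reg y))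
        (.seq p (.assign i (.add (.reg i) (.const 1))))) s' s'' t ∧
        t ≤ (d + 1) * (4 + (p.time B + 4)) ∧ Frame (forLoop i y p) s s'' ∧
        s''.reg i = s.reg y ∧ I (s.reg y) s'' := by
    intro d
    induction d with
    | zero =>
      intro j s' hj hF hr hI
      have hyv := hF.reg y hyf
      refine ⟨s', _, .loopDone ?_, ?_, hF, by omega, by rwa [← hj]⟩
      · rw [eval_lt_eq_zero, eval_reg, eval_reg]; omega
      · simp [Expr.cost]
    | succ d ih =>
      intro j s' hj hF hr hI
      have hyv := hF.reg y hyf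
      obtain ⟨s₁, t₁, h1, h2, h3⟩ := hstep j s' (by omega) hF hr hI
      have hF1 : Frame (forLoop i y p) s' s₁ := h1.frame.mono (fun x hx => (hi' x hx).2)
        (fun a ha => by simpa [forLoop, Prog.writesArr] using ha)
        (fun hf => by simpa [forLoop, Prog.flips] using hf)
      have hF2 : Frame (forLoop i y p) s₁ (s₁.setReg i (j + 1)) :=
        ⟨fun x hx => by simp [(hi' x hx).1], fun _ _ => rfl, fun _ => rfl⟩
      have hri : s₁.reg i = j := (h1.frame.reg i hi).trans hr
      obtain ⟨s₂, t₂, h4, h5, h6⟩ := ih (j + 1) (s₁.setReg i (j + 1)) (by omega)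
        ((hF.trans hF1).trans hF2) (by simp) h3
      have h7 : Exec ω (.assign i (.add (.reg i) (.const 1))) s₁ (s₁.setReg i (j + 1)) 4 := by
        have := Exec.assign (ω := ω) i (.add (.reg i) (.const 1)) s₁
        simpa [Expr.eval, Expr.cost, hri] using this
      refine ⟨s₂, _, .loopStep ?_ (.seq h1 h7) h4, ?_, h6⟩
      · rw [Ne, eval_lt_eq_zero, eval_reg, eval_reg]; omega
      · simp only [Expr.cost]
        rw [Nat.succ_mul]
        omega
  obtain ⟨s', t, h1, h2, h3, h4, h5⟩ := key (s.reg y) 0 (s.setReg i 0) (by omega)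
    ⟨fun x hx => by simp [(hi' x hx).1], fun _ _ => rfl, fun _ => rfl⟩ (by simp) h0
  refine ⟨s', _, .seq (.assign i (.const 0) s) h1, ?_, hQ s' h3 h4 h5⟩
  simp only [forLoop, Prog.time, Expr.cost]
  have : (s.reg y + 1) * (4 + (p.time B + 4)) ≤ (B + 1) * (1 + 1 + 1 + 1 + (p.time B + (1 + 1 + 1 + 1))) :=
    Nat.mul_le_mul_right _ (by omega)
  omega

end Runs

/-! ## The program for one vertex

Registers: `0` is `n`, `1` is `k`, `3` is `2 * n`, `9` is the vertex, `10` counts the augmentations,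
`11` tells whether the search has succeeded, `16` is the last rank given, `17` is the node of the
unit that is being pushed. Arrays: `3` holds the multiples of `n`, `4` the indicator of `U`, `5`
the residual capacities, `6` the indicator of the sources, `7` the ranks, `8` the successors. -/

section VertexProgram

/-- The index of the entry `(a, b)` of the residual matrix. -/
def entry (a b : Expr) : Expr := .add (.add (.get 3 a) (.get 3 a)) b

/-- The out-half of the vertex `a`. -/
def outHalf (a : Expr) : Expr := .add (.reg 0) a

/-- Store the capacities of the split digraph. -/
def capacityProg : Prog :=
  forLoop 14 0 (forLoop 15 0
    (.seq (.put 5 (entry (.reg 14) (.reg 15)) (.const 0))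
    (.seq (.put 5 (entry (outHalf (.reg 14)) (outHalf (.reg 15))) (.const 0))
    (.seq (.put 5 (entry (.reg 14) (outHalf (.reg 15))) (.eq (.reg 14) (.reg 15)))
    (.ite (.get 0 (.add (.get 3 (.reg 14)) (.reg 15)))
      (.put 5 (entry (outHalf (.reg 14)) (.reg 15)) (.add (.reg 1) (.const 1)))
      (.put 5 (entry (outHalf (.reg 14)) (.reg 15)) (.const 0)))))))

/-- Make the vertex the only source. -/
def sourceProg : Prog :=
  forLoop 14 0 (.put 6 (.reg 14) (.eq (.reg 14) (.reg 9)))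

/-- Rank the nodes of `W`. -/
def sinkProg : Prog :=
  forLoop 14 0 (.seq (.put 7 (.reg 14) (.get 1 (.reg 14)))
    (.put 7 (outHalf (.reg 14)) (.get 1 (.reg 14))))

/-- Rank the node in register `14` if it has an arc to the ranked node in register `15`. -/
def discoverProg : Prog :=
  .ite (.eq (.get 7 (.reg 14)) (.const 0))
    (.ite (.get 7 (.reg 15))
      (.ite (.get 5 (entry (.reg 14) (.reg 15)))
        (.seq (.assign 16 (.add (.reg 16) (.const 1)))
          (.seq (.put 7 (.reg 14) (.reg 16)) (.put 8 (.reg 14) (.reg 15))))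
        .skip) .skip) .skip

/-- Rank the nodes that reach `W` in the residual digraph. -/
def searchProg : Prog :=
  .seq sinkProg (.seq (.assign 16 (.const 1))
    (forLoop 20 3 (forLoop 14 3 (forLoop 15 3 discoverProg))))

/-- Find a ranked source. -/
def findProg : Prog :=
  .seq (.assign 17 (.reg 3))
    (forLoop 14 0 (.ite (.get 6 (.reg 14))
      (.ite (.get 7 (outHalf (.reg 14))) (.assign 17 (outHalf (.reg 14))) .skip) .skip))

/-- Push the unit along one arc. -/
def pushProg : Prog :=
  .seq (.assign 21 (.get 8 (.reg 17)))
  (.seq (.put 5 (entry (.reg 17) (.reg 21))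
    (.sub (.get 5 (entry (.reg 17) (.reg 21))) (.const 1)))
  (.seq (.put 5 (entry (.reg 21) (.reg 17))
    (.add (.get 5 (entry (.reg 21) (.reg 17))) (.const 1)))
  (.assign 17 (.reg 21))))

/-- Push one unit to `W`. -/
def augmentProg : Prog :=
  .seq (.assign 10 (.add (.reg 10) (.const 1)))
  (.seq (.assign 19 (.get 7 (.reg 17)))
  (forLoop 18 19 (.ite (.lt (.const 1) (.get 7 (.reg 17))) pushProg .skip)))

/-- Add the cut vertices outside `U` to the sources. -/
def enlargeProg : Prog :=
  .seq (.assign 11 (.const 1))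
  (forLoop 14 0 (.ite (.eq (.get 7 (.reg 14)) (.const 0))
    (.ite (.get 7 (outHalf (.reg 14)))
      (.ite (.eq (.get 4 (.reg 14)) (.const 0))
        (.seq (.put 6 (.reg 14) (.const 1)) (.assign 11 (.const 0))) .skip) .skip) .skip))

/-- One round of the search for an important separator. -/
def roundProg : Prog :=
  .ite (.reg 11) .skip (.ite (.lt (.reg 1) (.reg 10)) .skip
    (.seq searchProg (.seq findProg (.ite (.lt (.reg 17) (.reg 3)) augmentProg enlargeProg))))

/-- Decide whether `U` contains an important separator of size at most `k` for the vertex. -/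
def decideProg : Prog :=
  .seq capacityProg (.seq sourceProg (.seq (.assign 10 (.const 0)) (.seq (.assign 11 (.const 0))
    (forLoop 12 13 roundProg))))

/-! ### Memory layout and initialisation of the search -/

variable {n k : ℕ} {G : SimpleGraph (Fin n)} {W U : Finset (Fin n)}

open Classical in
/-- The registers and arrays that describe the input. -/
structure HasInput (G : SimpleGraph (Fin n)) (k : ℕ) (W : Finset (Fin n)) (s : State) : Prop where
  n_eq : s.reg 0 = n
  k_eq : s.reg 1 = k
  two_n : s.reg 3 = 2 * n
  rounds : s.reg 13 = n + k + 2
  row : ∀ a < 2 * n, s.arr 3 a = a * n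
  adj : ∀ a < n, ∀ b < n, s.arr 0 (a * n + b) ≠ 0 ↔ NatAdj G a b
  sinks : ∀ x : Fin n, s.arr 1 x = if x ∈ W then 1 else 0

theorem HasInput.frame {s s' : State} {p : Prog} (h : HasInput G k W s) (hF : Frame p s s')
    (h0 : p.writesReg 0 = false) (h1 : p.writesReg 1 = false) (h3 : p.writesReg 3 = false)
    (h13 : p.writesReg 13 = false) (ha0 : p.writesArr 0 = false) (ha1 : p.writesArr 1 = false)
    (ha3 : p.writesArr 3 = false) : HasInput G k W s' := by
  refine ⟨?_, ?_, ?_, ?_, ?_, ?_, ?_⟩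
  · rw [hF.reg 0 h0]; exact h.n_eq
  · rw [hF.reg 1 h1]; exact h.k_eq
  · rw [hF.reg 3 h3]; exact h.two_n
  · rw [hF.reg 13 h13]; exact h.rounds
  · rw [hF.arr 3 ha3]; exact h.row
  · rw [hF.arr 0 ha0]; exact h.adj
  · rw [hF.arr 1 ha1]; exact h.sinks

theorem HasInput.setReg {s : State} (h : HasInput G k W s) {x m : ℕ} (h0 : x ≠ 0) (h1 : x ≠ 1)
    (h3 : x ≠ 3) (h13 : x ≠ 13) : HasInput G k W (s.setReg x m) := by
  refine ⟨?_, ?_, ?_, ?_, h.row, h.adj, h.sinks⟩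
  · rw [setReg_reg, if_neg h0.symm]; exact h.n_eq
  · rw [setReg_reg, if_neg h1.symm]; exact h.k_eq
  · rw [setReg_reg, if_neg h3.symm]; exact h.two_n
  · rw [setReg_reg, if_neg h13.symm]; exact h.rounds

/-- The residual matrix. -/
def matrix (n : ℕ) (s : State) (a b : ℕ) : ℕ :=
  if a < 2 * n ∧ b < 2 * n then s.arr 5 (a * n + a * n + b) else 0

theorem matrix_of_lt {s : State} {a b : ℕ} (ha : a < 2 * n) (hb : b < 2 * n) :
    matrix n s a b = s.arr 5 (a * n + a * n + b) := if_pos ⟨ha, hb⟩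

theorem matrix_congr {s s' : State} (h : s'.arr 5 = s.arr 5) : matrix n s' = matrix n s := by
  funext a b
  simp only [matrix, h]

@[simp] theorem matrix_setReg (s : State) (x m : ℕ) :
    matrix n (s.setReg x m) = matrix n s := rfl

theorem index_inj {N a b a' b' : ℕ} (hb : b < N) (hb' : b' < N) :
    a * N + b = a' * N + b' ↔ a = a' ∧ b = b' := by
  constructor
  · intro h
    have h1 := congrArg (· / N) h
    have h2 := congrArg (· % N) h
    have hN : 0 < N := by omega
    simp only [mul_comm _ N, Nat.mul_add_div hN, Nat.div_eq_of_lt hb, Nat.div_eq_of_lt hb',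
      Nat.mul_add_mod, Nat.mod_eq_of_lt hb, Nat.mod_eq_of_lt hb'] at h1 h2
    exact ⟨by simpa using h1, h2⟩
  · rintro ⟨rfl, rfl⟩
    rfl

/-- Rows have length `2 * n`. The machine cannot multiply, so the row offset is a tabulated multiple
of `n` added to itself; distinct entries still have distinct addresses. -/
theorem matrix_setArr {s : State} {a b m : ℕ} (ha : a < 2 * n) (hb : b < 2 * n) :
    matrix n (s.setArr 5 (a * n + a * n + b) m) =
      fun x y => if x = a ∧ y = b then m else matrix n s x y := by
  funext x y
  unfold matrix
  by_cases hxy : x < 2 * n ∧ y < 2 * n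
  · have : x * n + x * n + y = a * n + a * n + b ↔ x = a ∧ y = b := by
      rw [← index_inj hxy.2 hb]
      constructor <;> intro h <;> linarith
    rw [if_pos hxy, if_pos hxy, setArr_arr]
    simp [this]
  · rw [if_neg hxy, if_neg hxy, if_neg]
    rintro ⟨rfl, rfl⟩
    exact hxy ⟨ha, hb⟩

theorem HasInput.eval_entry {s : State} (h : HasInput G k W s) {e f : Expr}
    (he : e.eval s < 2 * n) :
    (entry e f).eval s = e.eval s * n + e.eval s * n + f.eval s := by
  simp only [entry, eval_add, eval_get]
  rw [h.row _ he]

theorem HasInput.setArr {s : State} (h : HasInput G k W s) {a i m : ℕ} (h0 : a ≠ 0) (h1 : a ≠ 1)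
    (h3 : a ≠ 3) : HasInput G k W (s.setArr a i m) := by
  refine ⟨h.n_eq, h.k_eq, h.two_n, h.rounds, ?_, ?_, ?_⟩
  · intro b hb; rw [setArr_arr, if_neg fun h => h3 h.1.symm]; exact h.row b hb
  · intro b hb c hc; rw [setArr_arr, if_neg fun h => h0 h.1.symm]; exact h.adj b hb c hc
  · intro x; rw [setArr_arr, if_neg fun h => h1 h.1.symm]; exact h.sinks x

variable {B : ℕ} {ω : ℕ → Bool} {s : State}

theorem HasInput.runs_put (h : HasInput G k W s) {Q : State → Prop} {e f g : Expr} {a b m : ℕ}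
    (he : e.eval s = a) (hf : f.eval s = b) (hg : g.eval s = m) (ha : a < 2 * n)
    (hQ : Q (s.setArr 5 (a * n + a * n + b) m)) : Runs B ω (.put 5 (entry e f) g) s Q := by
  subst he hf hg
  refine Runs.put ?_
  rwa [h.eval_entry ha]

/-- The four blocks of the matrix are correct at `(x, y)`. -/
def CorrectAt (G : SimpleGraph (Fin n)) (k x y : ℕ) (r : ℕ → ℕ → ℕ) : Prop :=
  r x y = splitCapacity G k x y ∧ r (n + x) (n + y) = splitCapacity G k (n + x) (n + y) ∧
    r x (n + y) = splitCapacity G k x (n + y) ∧ r (n + x) y = splitCapacity G k (n + x) y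

/-- Both sides vanish outside the square of side `2 * n`, so they agree as functions. -/
theorem matrix_eq_splitCapacity (h : ∀ x < n, ∀ y < n, CorrectAt G k x y (matrix n s)) :
    matrix n s = splitCapacity G k := by
  funext a b
  by_cases hab : a < 2 * n ∧ b < 2 * n
  · by_cases ha : a < n <;> by_cases hb : b < n
    · exact (h a ha b hb).1
    · obtain ⟨c, rfl⟩ := Nat.exists_eq_add_of_le (not_lt.1 hb)
      exact (h a ha c (by omega)).2.2.1
    · obtain ⟨c, rfl⟩ := Nat.exists_eq_add_of_le (not_lt.1 ha)
      exact (h c (by omega) b hb).2.2.2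
    · obtain ⟨c, rfl⟩ := Nat.exists_eq_add_of_le (not_lt.1 ha)
      obtain ⟨d, rfl⟩ := Nat.exists_eq_add_of_le (not_lt.1 hb)
      exact (h c (by omega) d (by omega)).2.1
  · rw [matrix, if_neg hab, splitCapacity]
    split_ifs with h1 h2 h3
    · exact absurd ⟨by omega, by omega⟩ hab
    · rfl
    · obtain ⟨i, j, hi, hj, -⟩ := h3
      have := i.isLt
      have := j.isLt
      exact absurd ⟨by omega, by omega⟩ hab
    · rfl

theorem capacityProg_spec (h : HasInput G k W s) (hB : n ≤ B) :
    Runs B ω capacityProg s fun s' => matrix n s' = splitCapacity G k := by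
  refine Runs.for (fun j s => ∀ x < j, ∀ y < n, CorrectAt G k x y (matrix n s)) rfl rfl
    (by decide) (h.n_eq ▸ hB) (by simp) ?_ ?_
  swap
  · intro s' _ _ hI
    exact matrix_eq_splitCapacity (h.n_eq ▸ hI)
  intro i s₁ hi hF₁ hr₁ hI₁
  have h₁ := h.frame hF₁ rfl rfl rfl rfl rfl rfl rfl
  rw [h.n_eq] at hi
  refine Runs.for (fun j s => ∀ x y, y < n → (x < i ∨ x = i ∧ y < j) →
    CorrectAt G k x y (matrix n s)) rfl rfl (by decide) (h₁.n_eq ▸ hB) ?_ ?_ ?_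
  · rintro x y hy (hx | ⟨-, hx⟩)
    · exact hI₁ x hx y hy
    · omega
  swap
  · intro s' _ _ hI x hx y hy
    rw [matrix_setReg]
    exact hI x y hy (by rw [h₁.n_eq]; omega)
  intro j s₂ hj hF₂ hr₂ hI₂
  have h₂ := h₁.frame hF₂ rfl rfl rfl rfl rfl rfl rfl
  have hr₁₄ : s₂.reg 14 = i := (hF₂.reg 14 rfl).trans hr₁
  rw [h₁.n_eq] at hj
  refine Runs.seq (h₂.runs_put (a := i) (b := j) (m := 0) (by simp [hr₁₄]) (by simp [hr₂]) rfl
    (by omega) ?_)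
  have h₃ := h₂.setArr (a := 5) (i := i * n + i * n + j) (m := 0) (by decide) (by decide)
    (by decide)
  refine Runs.seq (h₃.runs_put (a := n + i) (b := n + j) (m := 0)
    (by simp [outHalf, hr₁₄, h₂.n_eq]) (by simp [outHalf, hr₂, h₂.n_eq]) rfl (by omega) ?_)
  have h₄ := h₃.setArr (a := 5) (i := (n + i) * n + (n + i) * n + (n + j)) (m := 0) (by decide)
    (by decide) (by decide)
  refine Runs.seq (h₄.runs_put (a := i) (b := n + j) (m := if i = j then 1 else 0)
    (by simp [hr₁₄]) (by simp [outHalf, hr₂, h₂.n_eq]) (by simp [Expr.eval, hr₁₄, hr₂])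
    (by omega) ?_)
  have h₅ := h₄.setArr (a := 5) (i := i * n + i * n + (n + j)) (m := if i = j then 1 else 0)
    (by decide) (by decide) (by decide)
  -- The two branches of the adjacency test differ only in the value `m` of the last write, so they
  -- are treated together.
  have key : ∀ m, m = splitCapacity G k (n + i) j → ∀ x y, y < n →
      (x < i ∨ x = i ∧ y < j + 1) → CorrectAt G k x y (matrix n (State.setReg (State.setArr
        (State.setArr (State.setArr (State.setArr s₂ 5 (i * n + i * n + j) 0) 5
        ((n + i) * n + (n + i) * n + (n + j)) 0) 5 (i * n + i * n + (n + j))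
        (if i = j then 1 else 0)) 5 ((n + i) * n + (n + i) * n + j) m) 15 (j + 1))) := by
    intro m hm x y hy hxy
    rw [matrix_setReg, matrix_setArr (by omega) (by omega),
      matrix_setArr (by omega) (by omega), matrix_setArr (by omega) (by omega),
      matrix_setArr (by omega) (by omega)]
    have e1 : x ≠ n + i := by omega
    have e2 : y ≠ n + j := by omega
    have e3 : n + x ≠ i := by omega
    have e4 : n + y ≠ j := by omega
    by_cases he : x = i ∧ y = j
    · obtain ⟨rfl, rfl⟩ := he
      unfold CorrectAt
      simp only [e1, e2, e3, e4, and_self, and_false, if_true, if_false, hm, and_true]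
      refine ⟨?_, ?_, ?_⟩
      · have e5 : y ≠ n + x := by omega
        simp [splitCapacity, hi, e5]
      · have : ¬ NatAdj G x (n + y) := by
          rintro ⟨_, j, -, hj, -⟩
          have := j.isLt
          omega
        simp [splitCapacity, this]
      · simp [splitCapacity, hi, eq_comm]
    · have e5 : ¬ (n + x = n + i ∧ n + y = n + j) := by omega
      have e6 : ¬ (n + x = n + i ∧ y = j) := by omega
      have e7 : ¬ (x = i ∧ n + y = n + j) := by omega
      have := hI₂ x y hy (by omega)
      unfold CorrectAt at this ⊢
      simpa only [e1, e2, e3, e4, e5, e6, e7, he, and_false, false_and, if_false] using this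
  have hget : Expr.eval (((s₂.setArr 5 (i * n + i * n + j) 0).setArr 5
      ((n + i) * n + (n + i) * n + (n + j)) 0).setArr 5 (i * n + i * n + (n + j))
      (if i = j then 1 else 0)) (.get 0 (.add (.get 3 (.reg 14)) (.reg 15))) =
      s₂.arr 0 (i * n + j) := by
    simp [hr₁₄, hr₂, h₂.row i (by omega)]
  refine Runs.ite (fun he => ?_) (fun he => ?_)
  · rw [hget] at he
    refine h₅.runs_put (a := n + i) (b := j) (m := k + 1) (by simp [outHalf, hr₁₄, h₂.n_eq])
      (by simp [hr₂]) (by simp [h₂.k_eq]) (by omega) (key _ ?_)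
    have := (h₂.adj i hi j hj).1 he
    simp [splitCapacity, this]
  · rw [hget] at he
    refine h₅.runs_put (a := n + i) (b := j) (m := 0) (by simp [outHalf, hr₁₄, h₂.n_eq])
      (by simp [hr₂]) rfl (by omega) (key _ ?_)
    have := mt (h₂.adj i hi j hj).2 (not_not.2 he)
    simp [splitCapacity, this]

/-- The set of vertices stored in array `a`. -/
def storedSet (n a : ℕ) (s : State) : Finset (Fin n) :=
  Finset.univ.filter fun x : Fin n => s.arr a x ≠ 0

theorem mem_storedSet {a : ℕ} {x : Fin n} : x ∈ storedSet n a s ↔ s.arr a x ≠ 0 := by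
  simp [storedSet]

theorem storedSet_congr {a : ℕ} {s' : State} (h : s'.arr a = s.arr a) :
    storedSet n a s' = storedSet n a s := by
  simp [storedSet, h]

@[simp] theorem storedSet_setReg (a : ℕ) (s : State) (x m : ℕ) :
    storedSet n a (s.setReg x m) = storedSet n a s := rfl

theorem sourceProg_spec (h : HasInput G k W s) (hB : n ≤ B) {v : Fin n} (hv : s.reg 9 = v) :
    Runs B ω sourceProg s fun s' => storedSet n 6 s' = {v} := by
  refine Runs.for (fun j s => ∀ x < j, s.arr 6 x ≠ 0 ↔ x = v.val) rfl rfl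
    (by decide) (h.n_eq ▸ hB) (by simp) ?_ ?_
  · intro i s₁ hi hF hr hI
    have hv' : s₁.reg 9 = v := (hF.reg 9 rfl).trans hv
    refine Runs.put fun x hx => ?_
    by_cases hxi : x = i
    · subst hxi
      simp [hr, Expr.eval, hv']
    · have := hI x (by omega)
      simp [hr, hxi, this]
  · intro s' _ _ hI
    rw [h.n_eq] at hI
    ext x
    rw [mem_storedSet, hI x x.isLt, Finset.mem_singleton, Fin.ext_iff]

end VertexProgram

/-! ### Correctness of the search for one vertex -/

section VertexProgram

variable {n k : ℕ} {G : SimpleGraph (Fin n)} {W U : Finset (Fin n)} {B : ℕ} {ω : ℕ → Bool}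
  {s : State}

theorem bothNodes_lt {a : ℕ} (h : a ∈ bothNodes W) : a < 2 * n := by
  obtain ⟨x, -, rfl | rfl⟩ := h <;> have := x.isLt <;> omega

theorem sinkProg_spec (h : HasInput G k W s) (hB : n ≤ B) :
    Runs B ω sinkProg s fun s' => ∀ a < 2 * n,
      (a ∈ bothNodes W → s'.arr 7 a = 1) ∧ (a ∉ bothNodes W → s'.arr 7 a = 0) := by
  refine Runs.for (fun j s' => ∀ x < j, s'.arr 7 x = s.arr 1 x ∧ s'.arr 7 (n + x) = s.arr 1 x)
    rfl rfl (by decide) (h.n_eq ▸ hB) (by simp) ?_ ?_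
  · intro i s₁ hi hF hr hI
    have h0 : s₁.reg 0 = n := (hF.reg 0 rfl).trans h.n_eq
    have h1 : s₁.arr 1 = s.arr 1 := hF.arr 1 rfl
    rw [h.n_eq] at hi
    refine Runs.seq (Runs.put (Runs.put fun x hx => ?_))
    by_cases hxi : x = i
    · subst hxi
      simp [hr, outHalf, h0, h1]
    · have := hI x (by omega)
      have e1 : x ≠ n + i := by omega
      have e2 : n + x ≠ i := by omega
      simp [hr, outHalf, h0, hxi, this, e1, e2]
  · intro s' _ _ hI
    rw [h.n_eq] at hI
    have key : ∀ x : Fin n, (x.val ∈ bothNodes W ↔ x ∈ W) ∧ (n + x.val ∈ bothNodes W ↔ x ∈ W) := by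
      refine fun x => ⟨⟨?_, fun hx => ⟨x, hx, Or.inl rfl⟩⟩, ⟨?_, fun hx => ⟨x, hx, Or.inr rfl⟩⟩⟩ <;>
        rintro ⟨y, hy, h | h⟩ <;> have h3 := x.isLt <;> have h4 := y.isLt
      · rwa [Fin.ext h]
      · omega
      · omega
      · rwa [Fin.ext (by omega : x.val = y.val)]
    intro a ha
    by_cases han : a < n
    · have h1 := (key ⟨a, han⟩).1
      have h2 := h.sinks ⟨a, han⟩
      simp only at h1 h2
      rw [h1, (hI a han).1, h2]
      constructor <;> intro h3 <;> simp [h3]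
    · obtain ⟨c, rfl⟩ := Nat.exists_eq_add_of_le (not_lt.1 han)
      have h1 := (key ⟨c, by omega⟩).2
      have h2 := h.sinks ⟨c, by omega⟩
      simp only at h1 h2
      rw [h1, (hI c (by omega)).2, h2]
      constructor <;> intro h3 <;> simp [h3]

/-- The labels during the search, where `stamp` is the last rank given. -/
structure IsPartialRanking (N : ℕ) (r : ℕ → ℕ → ℕ) (T : Set ℕ) (rank nxt : ℕ → ℕ)
    (stamp : ℕ) : Prop where
  sink : ∀ a < N, a ∈ T → rank a = 1
  step : ∀ a < N, rank a ≠ 0 → a ∈ T ∨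
    nxt a < N ∧ rank (nxt a) ≠ 0 ∧ rank (nxt a) < rank a ∧ r a (nxt a) ≠ 0
  one_lt : ∀ a < N, a ∉ T → rank a ≠ 0 → 1 < rank a
  le_stamp : ∀ a < N, rank a ≤ stamp
  pos : 1 ≤ stamp
  stamp_le : stamp ≤ 1 + ((Finset.range N).filter fun a => rank a ≠ 0).card

/-- No arc of positive capacity enters the set of ranked nodes. -/
def IsClosedRanking (N : ℕ) (r : ℕ → ℕ → ℕ) (rank : ℕ → ℕ) : Prop :=
  ∀ a < N, ∀ b < N, rank b ≠ 0 → r a b ≠ 0 → rank a ≠ 0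

theorem IsPartialRanking.stamp_le_succ {N : ℕ} {r : ℕ → ℕ → ℕ} {T : Set ℕ} {rank nxt : ℕ → ℕ}
    {stamp : ℕ} (h : IsPartialRanking N r T rank nxt stamp) : stamp ≤ 1 + N := by
  have := Finset.card_filter_le (Finset.range N) fun a => rank a ≠ 0
  have := h.stamp_le
  rw [Finset.card_range] at *
  omega

/-- The stamp grows only when a node is ranked; once it exceeds `N`, all nodes are ranked and
closedness is trivial. -/
theorem IsPartialRanking.closed_of_lt {N : ℕ} {r : ℕ → ℕ → ℕ} {T : Set ℕ} {rank nxt : ℕ → ℕ}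
    {stamp : ℕ} (h : IsPartialRanking N r T rank nxt stamp) (hN : N < stamp) :
    IsClosedRanking N r rank := by
  intro a ha b hb _ _
  have h1 := h.stamp_le
  have h2 : (Finset.range N).filter (fun a => rank a ≠ 0) = Finset.range N :=
    Finset.eq_of_subset_of_card_le (Finset.filter_subset _ _) (by rw [Finset.card_range]; omega)
  have h3 : a ∈ (Finset.range N).filter (fun a => rank a ≠ 0) := by
    rw [h2]; exact Finset.mem_range.2 ha
  exact (Finset.mem_filter.1 h3).2

theorem IsPartialRanking.isRanking {N : ℕ} {r : ℕ → ℕ → ℕ} {T : Set ℕ} {rank nxt : ℕ → ℕ}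
    {stamp : ℕ} (h : IsPartialRanking N r T rank nxt stamp) (hT : ∀ a ∈ T, a < N)
    (hc : IsClosedRanking N r rank) : IsRanking N r T rank nxt :=
  ⟨fun a ha => h.sink a (hT a ha) ha, h.step, h.one_lt, hc⟩

/-- The fresh rank exceeds all earlier ones, so the new node points to a smaller rank and no old
pointer is disturbed. -/
theorem IsPartialRanking.discover {N : ℕ} {r : ℕ → ℕ → ℕ} {T : Set ℕ} {rank nxt : ℕ → ℕ}
    {stamp a b : ℕ} (h : IsPartialRanking N r T rank nxt stamp) (ha : a < N) (hb : b < N)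
    (hra : rank a = 0) (hrb : rank b ≠ 0) (hr : r a b ≠ 0) :
    IsPartialRanking N r T (Function.update rank a (stamp + 1)) (Function.update nxt a b)
      (stamp + 1) := by
  have haT : a ∉ T := fun h' => by have := h.sink a ha h'; omega
  have hab : b ≠ a := fun h' => hrb (h' ▸ hra)
  refine ⟨fun x hx hxT => ?_, fun x hx hx0 => ?_, fun x hx hxT hx0 => ?_, fun x hx => ?_,
    by omega, ?_⟩
  · rw [Function.update_of_ne (fun h' : x = a => haT (h' ▸ hxT))]
    exact h.sink x hx hxT
  · by_cases hxa : x = a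
    · subst hxa
      right
      have := h.le_stamp b hb
      simp only [Function.update_self, Function.update_of_ne hab]
      exact ⟨hb, hrb, by omega, hr⟩
    · rw [Function.update_of_ne hxa] at hx0
      refine (h.step x hx hx0).imp_right fun ⟨h1, h2, h3, h4⟩ => ?_
      have hn : nxt x ≠ a := fun h' => h2 (h' ▸ hra)
      rw [Function.update_of_ne hxa, Function.update_of_ne hn, Function.update_of_ne hxa]
      exact ⟨h1, h2, h3, h4⟩
  · by_cases hxa : x = a
    · subst hxa
      have := h.pos
      rw [Function.update_self]
      omega
    · rw [Function.update_of_ne hxa] at hx0 ⊢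
      exact h.one_lt x hx hxT hx0
  · by_cases hxa : x = a
    · subst hxa
      rw [Function.update_self]
    · rw [Function.update_of_ne hxa]
      have := h.le_stamp x hx
      omega
  · have : insert a ((Finset.range N).filter fun x => rank x ≠ 0) ⊆
        (Finset.range N).filter fun x => Function.update rank a (stamp + 1) x ≠ 0 := by
      intro x hx
      simp only [Finset.mem_insert, Finset.mem_filter, Finset.mem_range] at hx ⊢
      by_cases hxa : x = a
      · subst hxa
        simp [ha]
      · rw [Function.update_of_ne hxa]
        exact hx.resolve_left hxa
    have h1 := Finset.card_le_card this
    rw [Finset.card_insert_of_notMem (by simp [hra])] at h1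
    have := h.stamp_le
    omega

/-- In round `i` of the sweeps, one of three things holds: the ranking is closed, the stamp has
reached `i + 2`, or the pairs checked so far, recorded by `P`, violate nothing. A discovery leads to
the second case. -/
theorem discoverProg_spec (h : HasInput G k W s) {r : ℕ → ℕ → ℕ} {T : Set ℕ} {a b i : ℕ}
    (hmat : matrix n s = r) (ha : s.reg 14 = a) (hb : s.reg 15 = b) (haN : a < 2 * n)
    (hbN : b < 2 * n) (hI : IsPartialRanking (2 * n) r T (s.arr 7) (s.arr 8) (s.reg 16))
    {P : ℕ → ℕ → Prop}
    (hP : IsClosedRanking (2 * n) r (s.arr 7) ∨ i + 2 ≤ s.reg 16 ∨ i + 1 ≤ s.reg 16 ∧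
      ∀ x < 2 * n, ∀ y < 2 * n, P x y → s.arr 7 y ≠ 0 → r x y ≠ 0 → s.arr 7 x ≠ 0) :
    Runs B ω discoverProg s fun s' =>
      IsPartialRanking (2 * n) r T (s'.arr 7) (s'.arr 8) (s'.reg 16) ∧
      (IsClosedRanking (2 * n) r (s'.arr 7) ∨ i + 2 ≤ s'.reg 16 ∨ i + 1 ≤ s'.reg 16 ∧
        ∀ x < 2 * n, ∀ y < 2 * n, P x y ∨ x = a ∧ y = b →
          s'.arr 7 y ≠ 0 → r x y ≠ 0 → s'.arr 7 x ≠ 0) := by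
  have hskip : (s.arr 7 b ≠ 0 → r a b ≠ 0 → s.arr 7 a ≠ 0) → Runs B ω .skip s fun s' =>
      IsPartialRanking (2 * n) r T (s'.arr 7) (s'.arr 8) (s'.reg 16) ∧
      (IsClosedRanking (2 * n) r (s'.arr 7) ∨ i + 2 ≤ s'.reg 16 ∨ i + 1 ≤ s'.reg 16 ∧
        ∀ x < 2 * n, ∀ y < 2 * n, P x y ∨ x = a ∧ y = b →
          s'.arr 7 y ≠ 0 → r x y ≠ 0 → s'.arr 7 x ≠ 0) := by
    refine fun hab => Runs.skip ⟨hI, hP.imp_right fun h' => h'.imp_right fun h' => ⟨h'.1, ?_⟩⟩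
    rintro x hx y hy (hxy | ⟨rfl, rfl⟩)
    · exact h'.2 x hx y hy hxy
    · exact hab
  have hent : (Expr.get 5 (entry (.reg 14) (.reg 15))).eval s = r a b := by
    rw [eval_get, h.eval_entry (by simpa [ha] using haN), ← hmat, matrix_of_lt haN hbN]
    simp [ha, hb]
  refine Runs.ite (fun h1 => Runs.ite (fun h2 => Runs.ite (fun h3 => ?_) fun h3 => ?_)
    fun h2 => ?_) fun h1 => ?_
  · have h1' : s.arr 7 a = 0 := by simpa [ha] using h1
    have h2' : s.arr 7 b ≠ 0 := by simpa [hb] using h2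
    rw [hent] at h3
    refine Runs.seq (Runs.assign (Runs.seq (Runs.put (Runs.put ⟨?_, Or.inr (Or.inl ?_)⟩))))
    · have := hI.discover haN hbN h1' h2' h3
      simpa [State.setArr, State.setReg, Expr.eval, ha, hb] using this
    · have : i + 1 ≤ s.reg 16 := by
        rcases hP with hP | hP | hP
        · exact absurd h1' (hP a haN b hbN h2' h3)
        · omega
        · exact hP.1
      simp; omega
  · rw [hent] at h3
    exact hskip fun _ h' => absurd h3 h'
  · exact hskip fun h' _ => absurd (by simpa [hb] using h2) h'
  · refine hskip fun _ _ => ?_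
    simpa [ha] using h1

theorem searchProg_spec (h : HasInput G k W s) (hB : 2 * n ≤ B) :
    Runs B ω searchProg s fun s' =>
      IsRanking (2 * n) (matrix n s) (bothNodes W) (s'.arr 7) (s'.arr 8) ∧
      ∀ a < 2 * n, s'.arr 7 a ≤ 2 * n + 1 := by
  refine Runs.seq ((sinkProg_spec h (by omega)).mono fun s₁ hF₁ hI₁ => ?_)
  have h₁ := h.frame hF₁ rfl rfl rfl rfl rfl rfl rfl
  have hm₁ : matrix n s₁ = matrix n s := matrix_congr (hF₁.arr 5 rfl)
  refine Runs.seq (Runs.assign ?_)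
  have h₂ := h₁.setReg (x := 16) (m := 1) (by decide) (by decide) (by decide) (by decide)
  have hpre : IsPartialRanking (2 * n) (matrix n s) (bothNodes W) (s₁.arr 7) (s₁.arr 8) 1 := by
    have key : ∀ a < 2 * n, s₁.arr 7 a ≠ 0 → a ∈ bothNodes W := fun a ha h0 => by
      by_contra hT
      exact h0 ((hI₁ a ha).2 hT)
    refine ⟨fun a ha => (hI₁ a ha).1, fun a ha h0 => Or.inl (key a ha h0),
      fun a ha hT h0 => absurd (key a ha h0) hT, fun a ha => ?_, le_rfl, by omega⟩
    by_cases hT : a ∈ bothNodes W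
    · exact ((hI₁ a ha).1 hT).le
    · rw [(hI₁ a ha).2 hT]; omega
  have h2n : (s₁.setReg 16 ((Expr.const 1).eval s₁)).reg 3 = 2 * n := h₂.two_n
  -- A sweep that discovers nothing proves closedness, and any other raises the stamp. After `2 * n`
  -- sweeps without closedness the stamp exceeds `2 * n`, and `IsPartialRanking.closed_of_lt`
  -- applies.
  refine Runs.for (fun i s' => IsPartialRanking (2 * n) (matrix n s) (bothNodes W) (s'.arr 7)
    (s'.arr 8) (s'.reg 16) ∧ (IsClosedRanking (2 * n) (matrix n s) (s'.arr 7) ∨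
      i + 1 ≤ s'.reg 16)) rfl rfl (by decide)
    (h2n ▸ hB) ?_ ?_ ?_
  · simpa using hpre
  swap
  · intro s' _ _ hI
    rw [h2n] at hI
    refine ⟨hI.1.isRanking (fun a ha => bothNodes_lt ha)
      (hI.2.elim id fun h' => hI.1.closed_of_lt h'), fun a ha => ?_⟩
    have := hI.1.le_stamp a ha
    have := hI.1.stamp_le_succ
    omega
  intro i s₃ hi hF₃ _ hI₃
  have h₃ := h₂.frame hF₃ rfl rfl rfl rfl rfl rfl rfl
  have hm₃ : matrix n s₃ = matrix n s := (matrix_congr (hF₃.arr 5 rfl)).trans hm₁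
  refine Runs.for (fun j s' => IsPartialRanking (2 * n) (matrix n s) (bothNodes W) (s'.arr 7)
    (s'.arr 8) (s'.reg 16) ∧ (IsClosedRanking (2 * n) (matrix n s) (s'.arr 7) ∨
      i + 2 ≤ s'.reg 16 ∨ i + 1 ≤ s'.reg 16 ∧ ∀ x < 2 * n, ∀ y < 2 * n, x < j →
        s'.arr 7 y ≠ 0 → matrix n s x y ≠ 0 → s'.arr 7 x ≠ 0)) rfl rfl (by decide)
    (by rw [h₃.two_n]; exact hB) ?_ ?_ ?_
  · simpa using ⟨hI₃.1, hI₃.2.imp_right Or.inr⟩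
  swap
  · intro s' _ _ hI
    rw [h₃.two_n] at hI
    refine ⟨hI.1, ?_⟩
    rcases hI.2 with h' | h' | h'
    · exact Or.inl h'
    · exact Or.inr (by simp; omega)
    · exact Or.inl fun a ha b hb => h'.2 a ha b hb ha
  intro j s₄ hj hF₄ hr₄ hI₄
  have h₄ := h₃.frame hF₄ rfl rfl rfl rfl rfl rfl rfl
  have hm₄ : matrix n s₄ = matrix n s := (matrix_congr (hF₄.arr 5 rfl)).trans hm₃
  rw [h₃.two_n] at hj
  refine Runs.for (fun l s' => IsPartialRanking (2 * n) (matrix n s) (bothNodes W) (s'.arr 7)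
    (s'.arr 8) (s'.reg 16) ∧ (IsClosedRanking (2 * n) (matrix n s) (s'.arr 7) ∨
      i + 2 ≤ s'.reg 16 ∨ i + 1 ≤ s'.reg 16 ∧ ∀ x < 2 * n, ∀ y < 2 * n, (x < j ∨ x = j ∧ y < l) →
        s'.arr 7 y ≠ 0 → matrix n s x y ≠ 0 → s'.arr 7 x ≠ 0)) rfl rfl (by decide)
    (by rw [h₄.two_n]; exact hB) ?_ ?_ ?_
  · simpa using hI₄
  swap
  · intro s' _ _ hI
    rw [h₄.two_n] at hI
    refine ⟨hI.1, hI.2.imp_right (Or.imp_right fun h' => ⟨h'.1, fun x hx y hy hxj => ?_⟩)⟩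
    exact h'.2 x hx y hy (by omega)
  intro l s₅ hl hF₅ hr₅ hI₅
  have h₅ := h₄.frame hF₅ rfl rfl rfl rfl rfl rfl rfl
  have hm₅ : matrix n s₅ = matrix n s := (matrix_congr (hF₅.arr 5 rfl)).trans hm₄
  have hr₁₄ : s₅.reg 14 = j := (hF₅.reg 14 rfl).trans hr₄
  rw [h₄.two_n] at hl
  refine (discoverProg_spec h₅ hm₅ hr₁₄ hr₅ hj hl hI₅.1 hI₅.2).mono fun s' _ hI => ?_
  refine ⟨hI.1, hI.2.imp_right (Or.imp_right fun h' => ⟨h'.1, fun x hx y hy hxj => ?_⟩)⟩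
  exact h'.2 x hx y hy (by omega)

/-- The value `2 * n`, which is not a node, signals that no source is ranked. -/
theorem findProg_spec (h : HasInput G k W s) (hB : n ≤ B) :
    Runs B ω findProg s fun s' =>
      (s'.reg 17 = 2 * n ∧ ∀ x ∈ storedSet n 6 s, s.arr 7 (n + x.val) = 0) ∨
      ∃ x ∈ storedSet n 6 s, s'.reg 17 = n + x.val ∧ s.arr 7 (n + x.val) ≠ 0 := by
  refine Runs.seq (Runs.assign ?_)
  refine Runs.for (fun j s' =>
    (s'.reg 17 = 2 * n ∧ ∀ x ∈ storedSet n 6 s, x.val < j → s.arr 7 (n + x.val) = 0) ∨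
      ∃ x ∈ storedSet n 6 s, s'.reg 17 = n + x.val ∧ s.arr 7 (n + x.val) ≠ 0)
    rfl rfl (by decide) (by simpa [h.n_eq] using hB) ?_ ?_ ?_
  · exact Or.inl ⟨by simp [h.two_n], fun x _ h' => absurd h' (Nat.not_lt_zero _)⟩
  · intro i s₁ hi hF hr hI
    have h6 : s₁.arr 6 = s.arr 6 := hF.arr 6 rfl
    have h7 : s₁.arr 7 = s.arr 7 := hF.arr 7 rfl
    have h0 : s₁.reg 0 = n := by rw [hF.reg 0 rfl]; simp [h.n_eq]
    have hi' : i < n := by simpa [h.n_eq] using hi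
    have hskip : (s.arr 6 i ≠ 0 → s.arr 7 (n + i) = 0) → Runs B ω .skip s₁ fun s' =>
        ((s'.setReg 14 (i + 1)).reg 17 = 2 * n ∧
          ∀ x ∈ storedSet n 6 s, x.val < i + 1 → s.arr 7 (n + x.val) = 0) ∨
        ∃ x ∈ storedSet n 6 s, (s'.setReg 14 (i + 1)).reg 17 = n + x.val ∧
          s.arr 7 (n + x.val) ≠ 0 := by
      refine fun hs => Runs.skip (hI.imp (fun h' => ⟨by simpa using h'.1, fun x hx hxi => ?_⟩)
        fun h' => by simpa using h')
      by_cases hxi' : x.val = i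
      · rw [hxi']; exact hs (hxi' ▸ mem_storedSet.1 hx)
      · exact h'.2 x hx (by omega)
    refine Runs.ite (fun h1 => Runs.ite (fun h2 => Runs.assign (Or.inr ?_)) fun h2 => ?_)
      fun h1 => ?_
    · refine ⟨⟨i, hi'⟩, mem_storedSet.2 ?_, by simp [outHalf, h0, hr], ?_⟩
      · simpa [hr, h6] using h1
      · simpa [outHalf, hr, h0, h7] using h2
    · refine hskip fun _ => ?_
      simpa [outHalf, hr, h0, h7] using h2
    · exact hskip fun h' => absurd (by simpa [hr, h6] using h1) h'
  · intro s' _ _ hI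
    simp only [setReg_reg, h.n_eq] at hI
    exact hI.imp_left fun h' => ⟨h'.1, fun x hx => h'.2 x hx (by simp)⟩

theorem augmentProg_spec (h : HasInput G k W s) {r : ℕ → ℕ → ℕ} (hmat : matrix n s = r)
    (hB : 2 * n + 1 ≤ B) {S : Finset (Fin n)} {x : Fin n} (hx : x ∈ S)
    (htok : s.reg 17 = n + x.val) (hrank : s.arr 7 (n + x.val) ≠ 0)
    (hR : IsRanking (2 * n) r (bothNodes W) (s.arr 7) (s.arr 8))
    (hle : ∀ a < 2 * n, s.arr 7 a ≤ 2 * n + 1) :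
    Runs B ω augmentProg s fun s' => s'.reg 10 = s.reg 10 + 1 ∧
      IsAugmentation (2 * n) r (matrix n s') (outNodes S) (bothNodes W) (s.arr 7) := by
  have hxN : n + x.val < 2 * n := by have := x.isLt; omega
  refine Runs.seq (Runs.assign (Runs.seq (Runs.assign ?_)))
  refine Runs.for (fun j s' => IsPartialPush (2 * n) r (matrix n s') (s.arr 7) (s.arr 8)
    (n + x.val) (s'.reg 17) ∧
      (s.arr 7 (s'.reg 17) ≤ 1 ∨ s.arr 7 (s'.reg 17) + j ≤ s.arr 7 (n + x.val))) rfl rfl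
    (by decide) (by simpa [htok] using (hle _ hxN).trans hB) ?_ ?_ ?_
  · refine ⟨?_, Or.inr ?_⟩
    · simpa [htok, hmat] using IsPartialPush.refl hxN hrank
    · simp [htok]
  · intro i s₁ hi hF hr hI
    have h₁ : HasInput G k W s₁ :=
      ((h.setReg (by decide) (by decide) (by decide) (by decide)).setReg (by decide) (by decide)
        (by decide) (by decide)).frame hF rfl rfl rfl rfl rfl rfl rfl
    have h7 : s₁.arr 7 = s.arr 7 := hF.arr 7 rfl
    have h8 : s₁.arr 8 = s.arr 8 := hF.arr 8 rfl
    refine Runs.ite (fun h1 => ?_) fun h1 => ?_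
    · have h1' : 1 < s.arr 7 (s₁.reg 17) := by simpa [h7] using h1
      obtain ⟨hstep, hlt⟩ := hI.1.step hR h1'
      have hab : s₁.reg 17 ≠ s.arr 8 (s₁.reg 17) := fun he => by rw [← he] at hlt; omega
      refine Runs.seq (Runs.assign ?_)
      set s₂ := s₁.setReg 21 ((Expr.get 8 (.reg 17)).eval s₁) with hs₂
      have h₂ : HasInput G k W s₂ := h₁.setReg (by decide) (by decide) (by decide) (by decide)
      have e17 : s₂.reg 17 = s₁.reg 17 := by simp [hs₂]
      have e21 : s₂.reg 21 = s.arr 8 (s₁.reg 17) := by simp [hs₂, h8]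
      have em : matrix n s₂ = matrix n s₁ := rfl
      refine Runs.seq (h₂.runs_put (a := s₁.reg 17) (b := s.arr 8 (s₁.reg 17))
        (m := matrix n s₁ (s₁.reg 17) (s.arr 8 (s₁.reg 17)) - 1) e17 e21 ?_ hI.1.lt ?_)
      · rw [eval_sub, eval_get, h₂.eval_entry (by simpa [e17] using hI.1.lt), ← em,
          matrix_of_lt hI.1.lt hstep.lt]
        simp [e17, e21]
      set s₃ := s₂.setArr 5 (s₁.reg 17 * n + s₁.reg 17 * n + s.arr 8 (s₁.reg 17))
        (matrix n s₁ (s₁.reg 17) (s.arr 8 (s₁.reg 17)) - 1) with hs₃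
      have h₃ : HasInput G k W s₃ := h₂.setArr (by decide) (by decide) (by decide)
      have em₃ : matrix n s₃ = _ := matrix_setArr hI.1.lt hstep.lt
      refine Runs.seq (h₃.runs_put (a := s.arr 8 (s₁.reg 17)) (b := s₁.reg 17)
        (m := matrix n s₁ (s.arr 8 (s₁.reg 17)) (s₁.reg 17) + 1) e21 e17 ?_ hstep.lt ?_)
      · rw [eval_add, eval_get, h₃.eval_entry (by simpa [hs₃, e21] using hstep.lt)]
        have e1 : (Expr.reg 21).eval s₃ = s.arr 8 (s₁.reg 17) := e21
        have e2 : (Expr.reg 17).eval s₃ = s₁.reg 17 := e17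
        rw [e1, e2, ← matrix_of_lt hstep.lt hI.1.lt, em₃]
        simp [hab.symm, em]
      refine Runs.assign ?_
      have e3 : (Expr.reg 21).eval (s₃.setArr 5 (s.arr 8 (s₁.reg 17) * n +
          s.arr 8 (s₁.reg 17) * n + s₁.reg 17) (matrix n s₁ (s.arr 8 (s₁.reg 17))
          (s₁.reg 17) + 1)) = s.arr 8 (s₁.reg 17) := e21
      rw [e3]
      simp only [setReg_reg, matrix_setReg, Nat.reduceEqDiff, if_false, if_true]
      rw [matrix_setArr hstep.lt hI.1.lt, em₃, em]
      refine ⟨?_, Or.inr ?_⟩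
      · convert hstep using 1
        funext a b
        unfold pushArc
        by_cases c1 : a = s₁.reg 17 ∧ b = s.arr 8 (s₁.reg 17)
        · obtain ⟨rfl, rfl⟩ := c1
          simp [hab]
        · simp only [c1, if_false]
      · rcases hI.2 with h' | h' <;> omega
    · have h1' : ¬ 1 < s.arr 7 (s₁.reg 17) := by simpa [h7] using h1
      exact Runs.skip ⟨by simpa using hI.1, Or.inl (by simpa using h1')⟩
  · intro s' hF _ hI
    refine ⟨by rw [hF.reg 10 rfl]; simp, hI.1.isAugmentation hR ⟨x, hx, rfl⟩ ?_⟩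
    -- The loop makes as many rounds as the rank of the starting node, and each push lowers the
    -- rank. The second alternative would leave rank zero, which is excluded, so the unit has
    -- reached rank `1`.
    have h1 := hI.1.rank_ne
    have h2 := hI.2
    simp only [htok, setReg_reg, setReg_arr, eval_get, eval_reg, reduceIte,
      Nat.reduceEqDiff] at h2
    omega

theorem enlargeProg_spec (h : HasInput G k W s) (hB : n ≤ B) (hU : storedSet n 4 s = U) :
    Runs B ω enlargeProg s fun s' =>
      storedSet n 6 s' = storedSet n 6 s ∪ (cutVertices n {a | s.arr 7 a = 0} \ U) ∧
      (s'.reg 11 = 0 ↔ (cutVertices n {a | s.arr 7 a = 0} \ U).Nonempty) := by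
  have hC : ∀ x : Fin n, x ∈ cutVertices n {a | s.arr 7 a = 0} \ U ↔
      s.arr 7 x = 0 ∧ s.arr 7 (n + x.val) ≠ 0 ∧ s.arr 4 x = 0 := by
    intro x
    rw [Finset.mem_sdiff, mem_cutVertices, ← hU, mem_storedSet, and_assoc, not_not]
    rfl
  set C := cutVertices n {a | s.arr 7 a = 0} \ U with hCdef
  refine Runs.seq (Runs.assign ?_)
  refine Runs.for (fun j s' => (∀ x : Fin n, s'.arr 6 x ≠ 0 ↔ s.arr 6 x ≠ 0 ∨ x ∈ C ∧ x.val < j) ∧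
    (s'.reg 11 = 0 ↔ ∃ x ∈ C, x.val < j)) rfl rfl (by decide) (by simpa [h.n_eq] using hB) ?_ ?_ ?_
  · simp
  · intro i s₁ hi hF hr hI
    have h4 : s₁.arr 4 = s.arr 4 := hF.arr 4 rfl
    have h7 : s₁.arr 7 = s.arr 7 := hF.arr 7 rfl
    have h0 : s₁.reg 0 = n := by rw [hF.reg 0 rfl]; simp [h.n_eq]
    have hi' : i < n := by simpa [h.n_eq] using hi
    have hskip : (⟨i, hi'⟩ : Fin n) ∉ C → Runs B ω .skip s₁ fun s' =>
        (∀ x : Fin n, (s'.setReg 14 (i + 1)).arr 6 x ≠ 0 ↔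
          s.arr 6 x ≠ 0 ∨ x ∈ C ∧ x.val < i + 1) ∧
        ((s'.setReg 14 (i + 1)).reg 11 = 0 ↔ ∃ x ∈ C, x.val < i + 1) := by
      intro hs
      have key : ∀ x : Fin n, x ∈ C ∧ x.val < i + 1 ↔ x ∈ C ∧ x.val < i := by
        refine fun x => and_congr_right fun hx => ?_
        have : x.val ≠ i := fun he => hs (by simpa [← he] using hx)
        omega
      refine Runs.skip ?_
      simpa only [key, setReg_reg, setReg_arr, Nat.reduceEqDiff, if_false] using hI
    refine Runs.ite (fun h1 => Runs.ite (fun h2 => Runs.ite (fun h3 => ?_) fun h3 => ?_)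
      fun h2 => ?_) fun h1 => ?_
    · have hiC : (⟨i, hi'⟩ : Fin n) ∈ C := (hC _).2
        ⟨by simpa [hr, h7] using h1, by simpa [outHalf, hr, h0, h7] using h2,
          by simpa [hr, h4] using h3⟩
      refine Runs.seq (Runs.put (Runs.assign ⟨fun x => ?_, ?_⟩))
      · by_cases hxi : x.val = i
        · have : x = ⟨i, hi'⟩ := Fin.ext hxi
          simp [this, hr, hiC]
        · have : x.val < i + 1 ↔ x.val < i := by omega
          simp only [setReg_arr, setArr_arr, eval_reg, hr, hxi, and_false, if_false, this]
          exact hI.1 x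
      · simp only [setReg_reg, Nat.reduceEqDiff, if_false, if_true, eval_const, true_iff]
        exact ⟨_, hiC, Nat.lt_succ_self i⟩
    · refine hskip fun h' => ?_
      have := ((hC _).1 h').2.2
      simp [hr, h4, this] at h3
    · refine hskip fun h' => ?_
      have := ((hC _).1 h').2.1
      simp [outHalf, hr, h0, h7, this] at h2
    · refine hskip fun h' => ?_
      have := ((hC _).1 h').1
      simp [hr, h7, this] at h1
  · intro s' _ _ hI
    have hn : ∀ x : Fin n, x.val < (s.setReg 11 ((Expr.const 1).eval s)).reg 0 := by
      intro x
      simp [h.n_eq]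
    refine ⟨?_, ?_⟩
    · ext x
      rw [mem_storedSet, hI.1 x, Finset.mem_union, mem_storedSet]
      simp only [hn, and_true]
    · rw [hI.2]
      simp only [hn, and_true]
      rfl

/-- Invariant of the rounds of the search. -/
structure RoundInv (G : SimpleGraph (Fin n)) (k : ℕ) (W U : Finset (Fin n)) (v : Fin n) (i : ℕ)
    (s : State) : Prop where
  found : s.reg 11 ≠ 0 → ∃ X, IsImportantSeparator G {v} W X ∧ X.card ≤ k ∧ X ⊆ U
  search : s.reg 11 = 0 →
    SearchInv G k W U v (storedSet n 6 s) (matrix n s) (s.reg 10) ∧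
      (s.reg 10 ≤ k → i ≤ s.reg 10 + (storedSet n 6 s).card)

/-- The potential is the flow value plus the number of sources: an augmentation raises the first,
and an unsuccessful cut adds a source, new because sources are uncut at that moment. -/
theorem roundProg_spec (h : HasInput G k W s) (hB : 2 * n + 1 ≤ B) (hU : storedSet n 4 s = U)
    {v : Fin n} {i : ℕ} (hI : RoundInv G k W U v i s) :
    Runs B ω roundProg s (RoundInv G k W U v (i + 1)) := by
  refine Runs.ite (fun h1 => Runs.skip ⟨hI.found, fun h' => absurd h' h1⟩) fun h1 => ?_
  obtain ⟨hinv, hcount⟩ := hI.search h1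
  refine Runs.ite (fun h2 => Runs.skip ?_) fun h2 => ?_
  · have : k < s.reg 10 := by simpa [h.k_eq] using h2
    exact ⟨hI.found, fun h' => ⟨hinv, fun h'' => by omega⟩⟩
  have hmk : s.reg 10 ≤ k := by simpa [h.k_eq] using h2
  refine Runs.seq ((searchProg_spec h (by omega)).mono fun s₁ hF₁ hI₁ => ?_)
  have h₁ := h.frame hF₁ rfl rfl rfl rfl rfl rfl rfl
  have hm₁ : matrix n s₁ = matrix n s := matrix_congr (hF₁.arr 5 rfl)
  have hS₁ : storedSet n 6 s₁ = storedSet n 6 s := storedSet_congr (hF₁.arr 6 rfl)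
  refine Runs.seq ((findProg_spec h₁ (by omega)).mono fun s₂ hF₂ hI₂ => ?_)
  have h₂ := h₁.frame hF₂ rfl rfl rfl rfl rfl rfl rfl
  have hm₂ : matrix n s₂ = matrix n s := (matrix_congr (hF₂.arr 5 rfl)).trans hm₁
  have hS₂ : storedSet n 6 s₂ = storedSet n 6 s := (storedSet_congr (hF₂.arr 6 rfl)).trans hS₁
  have hU₂ : storedSet n 4 s₂ = U :=
    ((storedSet_congr (hF₂.arr 4 rfl)).trans (storedSet_congr (hF₁.arr 4 rfl))).trans hU
  have h7 : s₂.arr 7 = s₁.arr 7 := hF₂.arr 7 rfl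
  have h8 : s₂.arr 8 = s₁.arr 8 := hF₂.arr 8 rfl
  have h10 : s₂.reg 10 = s.reg 10 := (hF₂.reg 10 rfl).trans (hF₁.reg 10 rfl)
  have h11 : s₂.reg 11 = s.reg 11 := (hF₂.reg 11 rfl).trans (hF₁.reg 11 rfl)
  obtain ⟨hR, hle⟩ := hI₁
  rw [hS₁] at hI₂
  rw [← h7, ← h8] at hR
  rw [← h7] at hle hI₂
  refine Runs.ite (fun h3 => ?_) fun h3 => ?_
  · have h3' : s₂.reg 17 < 2 * n := by simpa [h₂.two_n] using h3
    obtain ⟨x, hx, hxt, hxr⟩ := hI₂.resolve_left fun h' => by omega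
    refine (augmentProg_spec h₂ hm₂ hB hx hxt hxr hR hle).mono fun s₃ hF₃ hI₃ => ?_
    have hS₃ : storedSet n 6 s₃ = storedSet n 6 s := (storedSet_congr (hF₃.arr 6 rfl)).trans hS₂
    have h11' : s₃.reg 11 = 0 := ((hF₃.reg 11 rfl).trans h11).trans h1
    refine ⟨fun h' => absurd h11' h', fun _ => ?_⟩
    rw [hI₃.1, h10, hS₃]
    exact ⟨hinv.augment hR hI₃.2, fun _ => by have := hcount hmk; omega⟩
  · have h3' : ¬ s₂.reg 17 < 2 * n := by simpa [h₂.two_n] using h3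
    obtain ⟨-, hsat⟩ := hI₂.resolve_right fun ⟨x, _, hx, _⟩ => by have := x.isLt; omega
    refine (enlargeProg_spec h₂ (by omega) hU₂).mono fun s₃ hF₃ hI₃ => ?_
    have hm₃ : matrix n s₃ = matrix n s := (matrix_congr (hF₃.arr 5 rfl)).trans hm₂
    have h10' : s₃.reg 10 = s.reg 10 := (hF₃.reg 10 rfl).trans h10
    refine ⟨fun h' => ?_, fun h' => ?_⟩
    · rw [Ne, hI₃.2, Finset.not_nonempty_iff_eq_empty, Finset.sdiff_eq_empty_iff_subset] at h'
      exact hinv.exists_of_subset hmk hR hsat h'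
    · rw [hm₃, h10', hI₃.1, hS₂]
      refine ⟨hinv.enlarge hmk hR hsat, fun _ => ?_⟩
      obtain ⟨x, hx⟩ := hI₃.2.1 h'
      have hlt : storedSet n 6 s ⊂
          storedSet n 6 s ∪ (cutVertices n {a | s₂.arr 7 a = 0} \ U) := by
        refine (Finset.ssubset_iff_of_subset Finset.subset_union_left).2
          ⟨x, Finset.mem_union_right _ hx, fun hxS => ?_⟩
        exact (mem_cutVertices.1 (Finset.mem_sdiff.1 hx).1).2 (hsat x hxS)
      have := Finset.card_lt_card hlt
      have := hcount hmk
      omega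

theorem decideProg_spec (h : HasInput G k W s) (hB : 2 * n + k + 2 ≤ B) (hU : storedSet n 4 s = U)
    {v : Fin n} (hv : s.reg 9 = v) :
    Runs B ω decideProg s fun s' =>
      s'.reg 11 ≠ 0 ↔ ∃ X, IsImportantSeparator G {v} W X ∧ X.card ≤ k ∧ X ⊆ U := by
  refine Runs.seq ((capacityProg_spec h (by omega)).mono fun s₁ hF₁ hI₁ => ?_)
  have h₁ := h.frame hF₁ rfl rfl rfl rfl rfl rfl rfl
  refine Runs.seq ((sourceProg_spec h₁ (by omega) ((hF₁.reg 9 rfl).trans hv)).mono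
    fun s₂ hF₂ hI₂ => ?_)
  have h₂ := h₁.frame hF₂ rfl rfl rfl rfl rfl rfl rfl
  have hm₂ : matrix n s₂ = splitCapacity G k := (matrix_congr (hF₂.arr 5 rfl)).trans hI₁
  have hU₂ : storedSet n 4 s₂ = U :=
    ((storedSet_congr (hF₂.arr 4 rfl)).trans (storedSet_congr (hF₁.arr 4 rfl))).trans hU
  refine Runs.seq (Runs.assign (Runs.seq (Runs.assign ?_)))
  have h₃ := (h₂.setReg (x := 10) (m := (Expr.const 0).eval s₂) (by decide) (by decide) (by decide)
    (by decide)).setReg (x := 11) (m := (Expr.const 0).eval (s₂.setReg 10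
      ((Expr.const 0).eval s₂))) (by decide) (by decide) (by decide) (by decide)
  refine Runs.for (RoundInv G k W U v) rfl rfl (by decide) (by rw [h₃.rounds]; omega) ?_ ?_ ?_
  · refine ⟨fun h' => by simp at h', fun _ => ⟨?_, fun _ => Nat.zero_le _⟩⟩
    have e1 := SearchInv.init G k W U v
    rw [← hI₂, ← hm₂] at e1
    simpa using e1
  · intro i s₄ hi hF₄ _ hI₄
    have h₄ := h₃.frame hF₄ rfl rfl rfl rfl rfl rfl rfl
    refine (roundProg_spec h₄ (by omega) ((storedSet_congr (hF₄.arr 4 rfl)).trans hU₂)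
      hI₄).mono fun s' _ hI => ?_
    exact ⟨by simpa using hI.found, by simpa using hI.search⟩
  · intro s' _ _ hI
    refine ⟨hI.found, fun hX h0 => ?_⟩
    obtain ⟨h1, h2⟩ := hI.search h0
    have h3 := h1.le_of_exists hX
    have h4 := h2 h3
    -- With flow value at most `k` and at most `n` sources the potential is at most `n + k`, which
    -- `n + k + 2` rounds without success would exceed.
    rw [h₃.rounds] at h4
    have h5 := Finset.card_le_univ (storedSet n 6 s')
    rw [Fintype.card_fin] at h5
    omega

end VertexProgram

/-! ## The whole program

Registers: `2` is the number of trials, `5` the number of coins for one vertex, `7` the current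
trial, `8` the start of its output. -/

section MainProgram

/-- Store the multiples of `n`. -/
def rowProg : Prog :=
  forLoop 14 3 (.seq (.put 3 (.reg 14) (.reg 21)) (.assign 21 (.add (.reg 21) (.reg 0))))

/-- Compute the number of coins for one vertex. -/
def coinProg : Prog :=
  .seq (.assign 6 (.const 1)) (.seq (.assign 25 (.add (.reg 1) (.reg 1)))
    (forLoop 22 25 (.ite (.lt (.reg 6) (.reg 25))
      (.seq (.assign 6 (.add (.reg 6) (.reg 6))) (.assign 5 (.add (.reg 5) (.const 1)))) .skip)))

/-- Compute the number of trials. -/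
def countProg : Prog :=
  .seq (.assign 2 (.const 10)) (.seq (.assign 27 (.add (.reg 5) (.const 1)))
    (forLoop 14 1 (forLoop 15 27 (.assign 2 (.add (.reg 2) (.reg 2))))))

/-- The preparations. -/
def setupProg : Prog :=
  .seq (.assign 3 (.add (.reg 0) (.reg 0)))
  (.seq (.assign 13 (.add (.add (.reg 0) (.reg 1)) (.const 2)))
  (.seq rowProg (.seq coinProg countProg)))

/-- Flip coins for each vertex, and keep the vertex if they all come up heads. -/
def sampleProg : Prog :=
  forLoop 14 0 (.seq (.assign 23 (.const 1))
    (.seq (forLoop 22 5 (.seq (.flip 24) (.ite (.reg 24) .skip (.assign 23 (.const 0)))))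
      (.put 4 (.reg 14) (.reg 23))))

/-- Output whether the vertex is in the set of this trial. -/
def vertexProg : Prog :=
  .ite (.get 1 (.reg 9)) (.put 2 (.add (.reg 8) (.reg 9)) (.const 0))
    (.seq decideProg (.put 2 (.add (.reg 8) (.reg 9)) (.reg 11)))

/-- One trial. -/
def trialProg : Prog :=
  .seq sampleProg (.seq (forLoop 9 0 vertexProg) (.assign 8 (.add (.reg 8) (.reg 0))))

/-- The whole program. -/
def shadowProg : Prog := .seq setupProg (forLoop 7 2 trialProg)

/-- The number of coins for one vertex. -/
def coinCount (k : ℕ) : ℕ := Nat.clog 2 (2 * k)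

/-- The number of trials. -/
def trialCount (k : ℕ) : ℕ := 10 * 2 ^ ((coinCount k + 1) * k)

/-- The vertices kept when the coins used start at number `c`. -/
def sampleSet (n b c : ℕ) (ω : ℕ → Bool) : Finset (Fin n) :=
  Finset.univ.filter fun i : Fin n => ∀ j < b, ω (c + i.val * b + j) = true

theorem coinCount_le (k : ℕ) : coinCount k ≤ 2 * k :=
  Nat.clog_le_of_le_pow Nat.lt_two_pow_self.le

theorem two_mul_le_two_pow_coinCount (k : ℕ) : 2 * k ≤ 2 ^ coinCount k :=
  Nat.le_pow_clog one_lt_two _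

theorem two_pow_lt_iff_lt_coinCount {j k : ℕ} : 2 ^ j < 2 * k ↔ j < coinCount k := by
  rw [coinCount, Nat.lt_clog_iff_pow_lt one_lt_two]

theorem two_pow_coinCount_le {k : ℕ} (hk : k ≠ 0) : 2 ^ coinCount k ≤ 4 * k := by
  rcases Nat.eq_zero_or_pos (coinCount k) with h | h
  · rw [h]; omega
  · obtain ⟨d, hd⟩ := Nat.exists_eq_add_of_lt h
    have := two_pow_lt_iff_lt_coinCount.2 (show d < coinCount k by omega)
    rw [hd, zero_add, pow_succ]
    omega

/-! ### Correctness of the whole program -/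

variable {n k : ℕ} {G : SimpleGraph (Fin n)} {W U : Finset (Fin n)} {B : ℕ} {ω : ℕ → Bool}
  {s : State}

theorem rowProg_spec (h0 : s.reg 0 = n) (h3 : s.reg 3 = 2 * n) (h21 : s.reg 21 = 0)
    (hB : 2 * n ≤ B) : Runs B ω rowProg s fun s' => ∀ a < 2 * n, s'.arr 3 a = a * n := by
  refine Runs.for (fun j s' => s'.reg 21 = j * n ∧ ∀ a < j, s'.arr 3 a = a * n) rfl rfl
    (by decide) (h3 ▸ hB) (by simp [h21]) ?_ ?_
  · intro i s₁ hi hF hr hI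
    have e0 : s₁.reg 0 = n := (hF.reg 0 rfl).trans h0
    refine Runs.seq (Runs.put (Runs.assign ⟨?_, fun a ha => ?_⟩))
    · simp [hI.1, e0, Nat.succ_mul]
    · by_cases hai : a = i
      · simp [hr, hai, hI.1]
      · simp [hr, hai, hI.2 a (by omega)]
  · intro s' _ _ hI
    exact h3 ▸ hI.2

theorem coinProg_spec (h1 : s.reg 1 = k) (h5 : s.reg 5 = 0) (hB : 2 * k ≤ B) :
    Runs B ω coinProg s fun s' => s'.reg 5 = coinCount k := by
  refine Runs.seq (Runs.assign (Runs.seq (Runs.assign ?_)))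
  have e25 : ((s.setReg 6 ((Expr.const 1).eval s)).setReg 25 (((Expr.reg 1).add (.reg 1)).eval
      (s.setReg 6 ((Expr.const 1).eval s)))).reg 25 = 2 * k := by
    simp [h1, two_mul]
  -- The logarithm is found by doubling. The loop makes `2 * k` rounds, enough by `coinCount_le`,
  -- and rounds after the target are idle.
  refine Runs.for (fun j s' => s'.reg 6 = 2 ^ s'.reg 5 ∧ s'.reg 5 = min j (coinCount k)) rfl rfl
    (by decide) (e25 ▸ hB) (by simp [h5]) ?_ ?_
  · intro i s₁ hi hF hr hI
    have e25' : s₁.reg 25 = 2 * k := (hF.reg 25 rfl).trans e25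
    refine Runs.ite (fun h => ?_) fun h => ?_
    · simp only [Ne, eval_lt_eq_zero, not_not, eval_reg, e25', hI.1,
        two_pow_lt_iff_lt_coinCount] at h
      refine Runs.seq (Runs.assign (Runs.assign ?_))
      simp only [setReg_reg, eval_add, eval_reg, eval_const, Nat.reduceEqDiff, if_false, if_true,
        hI.1]
      refine ⟨by ring, ?_⟩
      omega
    · simp only [eval_lt_eq_zero, eval_reg, e25', hI.1, two_pow_lt_iff_lt_coinCount] at h
      refine Runs.skip ?_
      simp only [setReg_reg, Nat.reduceEqDiff, if_false]
      refine ⟨hI.1, ?_⟩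
      omega
  · intro s' _ _ hI
    rw [e25] at hI
    have := coinCount_le k
    omega

theorem countProg_spec (h1 : s.reg 1 = k) (h5 : s.reg 5 = coinCount k) (hB : 2 * k + 1 ≤ B) :
    Runs B ω countProg s fun s' => s'.reg 2 = trialCount k := by
  have hc := coinCount_le k
  refine Runs.seq (Runs.assign (Runs.seq (Runs.assign ?_)))
  refine Runs.for (fun j s' => s'.reg 2 = 10 * 2 ^ ((coinCount k + 1) * j)) rfl rfl
    (by decide) (by simp [h1]; omega) (by simp) ?_ ?_
  · intro i s₁ hi hF hr hI
    have e27 : s₁.reg 27 = coinCount k + 1 := by rw [hF.reg 27 rfl]; simp [h5]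
    refine Runs.for (fun j s' => s'.reg 2 = 10 * 2 ^ ((coinCount k + 1) * i + j)) rfl rfl
      (by decide) (by rw [e27]; omega) (by simpa using hI) ?_ ?_
    · intro j s₂ hj _ _ hJ
      refine Runs.assign ?_
      simp only [setReg_reg, eval_add, eval_reg, Nat.reduceEqDiff, if_false, if_true, hJ]
      ring
    · intro s' _ _ hJ
      rw [e27] at hJ
      simpa [Nat.mul_succ] using hJ
  · intro s' _ _ hI
    simpa [h1, trialCount] using hI

theorem setupProg_spec (hB : 2 * n + 2 * k + 1 ≤ B) :
    Runs B ω setupProg (inputState G W k) fun s' => HasInput G k W s' ∧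
      s'.reg 5 = coinCount k ∧ s'.reg 2 = trialCount k ∧ s'.reg 8 = 0 ∧ s'.coins = 0 := by
  have hpost : ∀ s', Frame setupProg (inputState G W k) s' → s'.reg 3 = 2 * n →
      s'.reg 13 = n + k + 2 → (∀ a < 2 * n, s'.arr 3 a = a * n) → HasInput G k W s' := by
    intro s' hF h3 h13 hrow
    refine ⟨?_, ?_, h3, h13, hrow, fun a ha b hb => ?_, fun x => ?_⟩
    · rw [hF.reg 0 rfl]; rfl
    · rw [hF.reg 1 rfl]; rfl
    · rw [hF.arr 0 rfl]
      simp only [inputState, if_true]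
      split_ifs with h
      · obtain ⟨i, j, hij, h⟩ := h
        obtain ⟨rfl, rfl⟩ := (index_inj hb j.isLt).1 hij
        exact ⟨fun _ => ⟨i, j, rfl, rfl, h⟩, fun _ => one_ne_zero⟩
      · refine ⟨fun h' => absurd rfl h', ?_⟩
        rintro ⟨i, j, rfl, rfl, h'⟩
        exact absurd ⟨i, j, rfl, h'⟩ h
    · rw [hF.arr 1 rfl]
      simp only [inputState, one_ne_zero, if_false, if_true]
      congr 1
      refine propext ⟨?_, fun hx => ⟨x, rfl, hx⟩⟩
      rintro ⟨i, hi, hiW⟩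
      rwa [Fin.ext hi]
  have hrun : Runs B ω setupProg (inputState G W k) fun s' => s'.reg 3 = 2 * n ∧
      s'.reg 13 = n + k + 2 ∧ (∀ a < 2 * n, s'.arr 3 a = a * n) ∧ s'.reg 5 = coinCount k ∧
      s'.reg 2 = trialCount k := by
    refine Runs.seq (Runs.assign (Runs.seq (Runs.assign ?_)))
    set s₀ := ((inputState G W k).setReg 3 _).setReg 13 _ with hs₀
    have e0 : s₀.reg 0 = n := by simp [hs₀, inputState]
    have e1 : s₀.reg 1 = k := by simp [hs₀, inputState]
    have e3 : s₀.reg 3 = 2 * n := by simp [hs₀, inputState, two_mul]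
    have e13 : s₀.reg 13 = n + k + 2 := by simp [hs₀, inputState]
    have e21 : s₀.reg 21 = 0 := by simp [hs₀, inputState]
    have e5 : s₀.reg 5 = 0 := by simp [hs₀, inputState]
    refine Runs.seq ((rowProg_spec e0 e3 e21 (by omega)).mono fun s₁ hF₁ hI₁ => ?_)
    refine Runs.seq ((coinProg_spec ((hF₁.reg 1 rfl).trans e1) ((hF₁.reg 5 rfl).trans e5)
      (by omega)).mono fun s₂ hF₂ hI₂ => ?_)
    refine (countProg_spec ((hF₂.reg 1 rfl).trans ((hF₁.reg 1 rfl).trans e1)) hI₂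
      (by omega)).mono fun s₃ hF₃ hI₃ => ⟨?_, ?_, ?_, ?_, hI₃⟩
    · rw [hF₃.reg 3 rfl, hF₂.reg 3 rfl, hF₁.reg 3 rfl, e3]
    · rw [hF₃.reg 13 rfl, hF₂.reg 13 rfl, hF₁.reg 13 rfl, e13]
    · rw [hF₃.arr 3 rfl, hF₂.arr 3 rfl]
      exact hI₁
    · rw [hF₃.reg 5 rfl, hI₂]
  refine hrun.mono fun s' hF ⟨h3, h13, hrow, h5, h2⟩ => ⟨hpost s' hF h3 h13 hrow, h5, h2, ?_, ?_⟩
  · rw [hF.reg 8 rfl]; rfl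
  · rw [hF.coins rfl]; rfl

theorem sampleProg_spec {b c : ℕ} (h0 : s.reg 0 = n) (h5 : s.reg 5 = b) (hc : s.coins = c)
    (hB : n ≤ B) (hB' : b ≤ B) : Runs B ω sampleProg s fun s' =>
      storedSet n 4 s' = sampleSet n b c ω ∧ s'.coins = c + n * b := by
  refine Runs.for (fun i s' => s'.coins = c + i * b ∧
    ∀ a < i, s'.arr 4 a ≠ 0 ↔ ∀ j < b, ω (c + a * b + j) = true) rfl rfl (by decide) (h0 ▸ hB)
    (by simp [hc]) ?_ ?_
  · intro i s₁ hi hF hr hI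
    have e5 : s₁.reg 5 = b := (hF.reg 5 rfl).trans h5
    refine Runs.seq (Runs.assign (Runs.seq ?_))
    refine Runs.for (fun l s' => s'.coins = c + i * b + l ∧
      (s'.reg 23 ≠ 0 ↔ ∀ j < l, ω (c + i * b + j) = true)) rfl rfl (by decide)
      (by simpa [e5] using hB') (by simp [hI.1]) ?_ ?_
    · intro l s₂ hl hF₂ hr₂ hI₂
      refine Runs.seq (Runs.flip ?_)
      have key : (∀ j < l + 1, ω (c + i * b + j) = true) ↔
          (∀ j < l, ω (c + i * b + j) = true) ∧ ω (c + i * b + l) = true := by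
        rw [Nat.forall_lt_succ_right]
      refine Runs.ite (fun h => Runs.skip ⟨?_, ?_⟩) fun h => Runs.assign ⟨?_, ?_⟩
      · simp [hI₂.1, add_assoc]
      · have h' : ω (c + i * b + l) = true := by simpa [hI₂.1] using h
        rw [key]
        simpa [h'] using hI₂.2
      · simp [hI₂.1, add_assoc]
      · have h' : ω (c + i * b + l) = false := by simpa [hI₂.1] using h
        rw [key]
        simp [h']
    · intro s₂ hF₂ _ hI₂
      have e14 : s₂.reg 14 = i := by rw [hF₂.reg 14 rfl]; simp [hr]
      have e4 : s₂.arr 4 = s₁.arr 4 := hF₂.arr 4 rfl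
      simp only [setReg_reg, Nat.reduceEqDiff, if_false, e5] at hI₂
      refine Runs.put ⟨?_, fun a ha => ?_⟩
      · simp [hI₂.1, Nat.succ_mul, add_assoc]
      · by_cases hai : a = i
        · subst hai
          simpa [e14] using hI₂.2
        · simpa [e14, hai, e4] using hI.2 a (by omega)
  · intro s' _ _ hI
    rw [h0] at hI
    refine ⟨?_, hI.1⟩
    ext x
    rw [mem_storedSet, hI.2 x x.isLt]
    simp [sampleSet]

theorem vertexProg_spec (h : HasInput G k W s) (hB : 2 * n + k + 2 ≤ B)
    (hU : storedSet n 4 s = U) {v : Fin n} (hv : s.reg 9 = v) {d : ℕ} (hd : s.reg 8 = d) :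
    Runs B ω vertexProg s fun s' => (∀ m, m ≠ d + v.val → s'.arr 2 m = s.arr 2 m) ∧
      (s'.arr 2 (d + v.val) ≠ 0 ↔ v ∉ W ∧
        ∃ X, IsImportantSeparator G {v} W X ∧ X.card ≤ k ∧ X ⊆ U) := by
  have hW : (Expr.get 1 (.reg 9)).eval s ≠ 0 ↔ v ∈ W := by
    simp [hv, h.sinks v]
  refine Runs.ite (fun h1 => Runs.put ?_) fun h1 => Runs.seq ?_
  · rw [hW] at h1
    simp +contextual [hv, hd, h1]
  · have h1' : v ∉ W := fun h' => hW.2 h' h1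
    refine (decideProg_spec h hB hU hv).mono fun s₁ hF₁ hI₁ => Runs.put ?_
    have e9 : s₁.reg 9 = v := (hF₁.reg 9 rfl).trans hv
    have e8 : s₁.reg 8 = d := (hF₁.reg 8 rfl).trans hd
    have e2 : s₁.arr 2 = s.arr 2 := hF₁.arr 2 rfl
    refine ⟨fun m hm => ?_, ?_⟩
    · simp [e8, e9, hm, e2]
    · rw [← hI₁]
      simp [e8, e9, h1']

/-- Only the sampling flips coins, always `n * b` of them. The coin positions of a trial are
therefore fixed in advance, which later gives independence of the trials. -/
theorem trialProg_spec (h : HasInput G k W s) {b c d : ℕ} (hB : 2 * n + k + 2 ≤ B) (hB' : b ≤ B)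
    (h5 : s.reg 5 = b) (hc : s.coins = c) (hd : s.reg 8 = d) :
    Runs B ω trialProg s fun s' => s'.reg 8 = d + n ∧ s'.coins = c + n * b ∧
      (∀ m < d, s'.arr 2 m = s.arr 2 m) ∧
      ∀ v : Fin n, s'.arr 2 (d + v.val) ≠ 0 ↔ v ∉ W ∧
        ∃ X, IsImportantSeparator G {v} W X ∧ X.card ≤ k ∧ X ⊆ sampleSet n b c ω := by
  refine Runs.seq ((sampleProg_spec h.n_eq h5 hc (by omega) hB').mono fun s₁ hF₁ hI₁ => ?_)
  have h₁ := h.frame hF₁ rfl rfl rfl rfl rfl rfl rfl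
  have hd₁ : s₁.reg 8 = d := (hF₁.reg 8 rfl).trans hd
  have e2 : s₁.arr 2 = s.arr 2 := hF₁.arr 2 rfl
  refine Runs.seq ?_
  refine Runs.for (fun j s' => (∀ m < d, s'.arr 2 m = s.arr 2 m) ∧
    ∀ v : Fin n, v.val < j → (s'.arr 2 (d + v.val) ≠ 0 ↔ v ∉ W ∧
      ∃ X, IsImportantSeparator G {v} W X ∧ X.card ≤ k ∧ X ⊆ sampleSet n b c ω)) rfl rfl
    (by decide) (by rw [h₁.n_eq]; omega) ?_ ?_ ?_
  · exact ⟨fun m _ => by simp [e2], fun v hv => absurd hv (Nat.not_lt_zero _)⟩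
  · intro i s₂ hi hF₂ hr₂ hI₂
    have h₂ := h₁.frame hF₂ rfl rfl rfl rfl rfl rfl rfl
    rw [h₁.n_eq] at hi
    refine (vertexProg_spec h₂ hB ((storedSet_congr (hF₂.arr 4 rfl)).trans hI₁.1) (v := ⟨i, hi⟩)
      hr₂ ((hF₂.reg 8 rfl).trans hd₁)).mono fun s₃ _ hI₃ => ?_
    refine ⟨fun m hm => ?_, fun v hv => ?_⟩
    · rw [setReg_arr, hI₃.1 m (by simp only; omega)]
      exact hI₂.1 m hm
    · rw [setReg_arr]
      by_cases hvi : v = ⟨i, hi⟩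
      · rw [hvi]; exact hI₃.2
      · have hne : v.val ≠ i := fun h' => hvi (Fin.ext h')
        rw [hI₃.1 _ (by simp only; omega)]
        exact hI₂.2 v (by omega)
  · intro s₂ hF₂ _ hI₂
    have h₂ := h₁.frame hF₂ rfl rfl rfl rfl rfl rfl rfl
    refine Runs.assign ⟨?_, ?_, ?_, fun v => ?_⟩
    · simp [h₂.n_eq, (hF₂.reg 8 rfl).trans hd₁]
    · rw [setReg_coins, hF₂.coins rfl]; exact hI₁.2
    · simpa using hI₂.1
    · exact hI₂.2 v (by rw [h₁.n_eq]; exact v.isLt)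

/-- What the program computes. -/
theorem shadowProg_spec (G : SimpleGraph (Fin n)) (k : ℕ) (W : Finset (Fin n)) (ω : ℕ → Bool)
    (hB : trialCount k + 2 * n + 2 * k + 2 ≤ B) :
    Runs B ω shadowProg (inputState G W k) fun s' => s'.reg 2 = trialCount k ∧
      ∀ t < trialCount k, ∀ v : Fin n, s'.arr 2 (t * n + v.val) ≠ 0 ↔ v ∉ W ∧
        ∃ X, IsImportantSeparator G {v} W X ∧ X.card ≤ k ∧
          X ⊆ sampleSet n (coinCount k) (t * (n * coinCount k)) ω := by
  have hck := coinCount_le k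
  refine Runs.seq ((setupProg_spec (by omega)).mono fun s₁ _ ⟨h₁, e5, e2, e8, ec⟩ => ?_)
  refine Runs.for (fun i s' => s'.reg 8 = i * n ∧ s'.coins = i * (n * coinCount k) ∧
    ∀ t < i, ∀ v : Fin n, s'.arr 2 (t * n + v.val) ≠ 0 ↔ v ∉ W ∧
        ∃ X, IsImportantSeparator G {v} W X ∧ X.card ≤ k ∧
          X ⊆ sampleSet n (coinCount k) (t * (n * coinCount k)) ω) rfl rfl (by decide)
    (by rw [e2]; omega) (by simp [e8, ec]) ?_ ?_
  · intro i s₂ hi hF₂ hr₂ hI₂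
    have h₂ := h₁.frame hF₂ rfl rfl rfl rfl rfl rfl rfl
    refine (trialProg_spec h₂ (by omega) (by omega) ((hF₂.reg 5 rfl).trans e5) hI₂.2.1
      hI₂.1).mono fun s₃ _ hI₃ => ⟨?_, ?_, fun t ht v => ?_⟩
    · simp [hI₃.1, Nat.succ_mul]
    · simp [hI₃.2.1, Nat.succ_mul]
    · rw [setReg_arr]
      by_cases hti : t = i
      · rw [hti]; exact hI₃.2.2.2 v
      · have hlt : t * n + v.val < i * n := by
          have h1 := Nat.mul_le_mul_right n (show t + 1 ≤ i by omega)
          rw [Nat.succ_mul] at h1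
          have := v.isLt
          omega
        rw [hI₃.2.2.1 _ hlt]
        exact hI₂.2.2 t (by omega) v
  · intro s' hF _ hI
    rw [e2] at hI
    exact ⟨(hF.reg 2 rfl).trans e2, hI.2.2⟩

end MainProgram

/-! ## The probability of a good trial -/

section Probability

open MeasureTheory

/-- The law of one fair coin. -/
noncomputable def coinLaw : Measure Bool := (PMF.uniformOfFintype Bool).toMeasure

instance : IsProbabilityMeasure coinLaw := by
  unfold coinLaw
  infer_instance

instance : IsProbabilityMeasure coinMeasure :=
  inferInstanceAs (IsProbabilityMeasure (Measure.infinitePi fun _ : ℕ => coinLaw))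

/-- The law of the coins of one vertex. -/
noncomputable def vertexLaw (b : ℕ) : Measure (Fin b → Bool) := Measure.infinitePi fun _ => coinLaw

instance (b : ℕ) : IsProbabilityMeasure (vertexLaw b) := by
  unfold vertexLaw
  infer_instance

/-- The law of the coins of one trial. -/
noncomputable def trialLaw (n b : ℕ) : Measure (Fin n → Fin b → Bool) :=
  Measure.infinitePi fun _ => vertexLaw b

instance (n b : ℕ) : IsProbabilityMeasure (trialLaw n b) := by
  unfold trialLaw
  infer_instance

theorem coinIndex_injective (T n b : ℕ) : Function.Injective
    fun p : (Fin T × Fin n) × Fin b => p.1.1.val * (n * b) + p.1.2.val * b + p.2.val := by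
  rintro ⟨⟨t, i⟩, j⟩ ⟨⟨t', i'⟩, j'⟩ h
  have h' : (t.val * n + i.val) * b + j.val = (t'.val * n + i'.val) * b + j'.val := by
    simp only at h
    rw [add_mul, add_mul, mul_assoc, mul_assoc]
    exact h
  obtain ⟨h1, h2⟩ := (index_inj j.isLt j'.isLt).1 h'
  obtain ⟨h3, h4⟩ := (index_inj i.isLt i'.isLt).1 h1
  rw [Fin.ext h2, Fin.ext h3, Fin.ext h4]

/-- Distinct positions carry independent coins, so an injective reindexing of the sequence is again
a product measure; currying twice groups the coins by vertex and by trial. -/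
theorem coinMeasure_map (T n b : ℕ) : coinMeasure.map
    (fun ω (t : Fin T) (i : Fin n) (j : Fin b) => ω (t.val * (n * b) + i.val * b + j.val)) =
      Measure.infinitePi fun _ => trialLaw n b := by
  have h1 := Measure.map_infinitePi_infinitePi_of_inj (P := fun _ : ℕ => coinLaw)
    (coinIndex_injective T n b)
  have h2 := Measure.infinitePi_map_curry (fun (_ : Fin T × Fin n) (_ : Fin b) => coinLaw)
  have h3 := Measure.infinitePi_map_curry (fun (_ : Fin T) (_ : Fin n) => vertexLaw b)
  rw [← h1, Measure.map_map (by fun_prop) (by fun_prop)] at h2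
  change _ = Measure.infinitePi fun _ => vertexLaw b at h2
  rw [← h2, Measure.map_map (by fun_prop) (by fun_prop)] at h3
  exact h3

theorem coinLaw_real_singleton (x : Bool) : coinLaw.real {x} = 1 / 2 := by
  rw [Measure.real, coinLaw, PMF.toMeasure_apply_singleton _ _ (measurableSet_singleton x)]
  simp

theorem vertexLaw_real_heads (b : ℕ) : (vertexLaw b).real {fun _ => true} = (1 / 2) ^ b := by
  have : ({fun _ => true} : Set (Fin b → Bool)) =
      Set.pi (Finset.univ : Finset (Fin b)) fun _ => {true} := by
    ext x
    simp [funext_iff]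
  rw [Measure.real, this, vertexLaw, Measure.infinitePi_pi _ (fun _ _ => measurableSet_singleton _),
    ENNReal.toReal_prod]
  change ∏ _ : Fin b, coinLaw.real {true} = _
  simp [coinLaw_real_singleton]

/-- All coins of the vertices in `Y` and not all coins of any vertex in `H` come up heads. -/
def GoodTrial {n b : ℕ} (Y H : Finset (Fin n)) : Set (Fin n → Fin b → Bool) :=
  {y | (∀ i ∈ Y, y i = fun _ => true) ∧ ∀ i ∈ H, y i ≠ fun _ => true}

theorem trialLaw_real_goodTrial {n b : ℕ} {Y H : Finset (Fin n)} (h : Disjoint Y H) :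
    (trialLaw n b).real (GoodTrial Y H) = ((1 / 2) ^ b) ^ Y.card * (1 - (1 / 2) ^ b) ^ H.card := by
  classical
  have : (GoodTrial Y H : Set (Fin n → Fin b → Bool)) =
      Set.pi (Y ∪ H : Finset (Fin n)) fun i => if i ∈ Y then {fun _ => true}
        else {fun _ => true}ᶜ := by
    ext y
    simp only [GoodTrial, Set.mem_pi, Finset.coe_union, Set.mem_union, Finset.mem_coe]
    constructor
    · rintro ⟨h1, h2⟩ i hi
      by_cases hiY : i ∈ Y
      · simpa [hiY] using h1 i hiY
      · simpa [hiY] using h2 i (hi.resolve_left hiY)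
    · refine fun h1 => ⟨fun i hi => by simpa [hi] using h1 i (Or.inl hi), fun i hi => ?_⟩
      have hiY : i ∉ Y := Finset.disjoint_right.1 h hi
      simpa [hiY] using h1 i (Or.inr hi)
  rw [Measure.real, this, trialLaw, Measure.infinitePi_pi _ (fun _ _ => .of_discrete),
    ENNReal.toReal_prod, Finset.prod_union h]
  congr 1
  · rw [← vertexLaw_real_heads, ← Finset.prod_const]
    exact Finset.prod_congr rfl fun i hi => by simp [hi, Measure.real]
  · rw [← vertexLaw_real_heads, ← probReal_compl_eq_one_sub .of_discrete, ← Finset.prod_const]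
    exact Finset.prod_congr rfl fun i hi => by
      simp [Finset.disjoint_right.1 h hi, Measure.real]

/-- With `p = 2^-coinCount k` one has `k * p ≤ 1/2`, so Bernoulli's inequality gives `(1 - p)^k ≥
1/2`, and avoiding `k * (k + 1)` vertices costs only a factor `2^(k + 1)`. -/
theorem one_half_pow_le_goodTrial {k y h : ℕ} (hy : y ≤ k) (hh : h ≤ k * (k + 1)) :
    (1 / 2 : ℝ) ^ ((coinCount k + 1) * k + 1) ≤
      ((1 / 2) ^ coinCount k) ^ y * (1 - (1 / 2) ^ coinCount k) ^ h := by
  set p : ℝ := (1 / 2) ^ coinCount k with hp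
  have hp0 : 0 ≤ p := by positivity
  have hp1 : p ≤ 1 := pow_le_one₀ (by norm_num) (by norm_num)
  have hkp : k * p ≤ 1 / 2 := by
    have h1 : ((2 * k : ℕ) : ℝ) ≤ ((2 ^ coinCount k : ℕ) : ℝ) :=
      Nat.cast_le.2 (two_mul_le_two_pow_coinCount k)
    have h2 : p * 2 ^ coinCount k = 1 := by
      rw [hp, ← mul_pow]
      norm_num
    push_cast at h1
    nlinarith
  have h3 : (1 / 2 : ℝ) ≤ (1 - p) ^ k := by
    have := one_add_mul_le_pow (a := -p) (by linarith) k
    rw [← sub_eq_add_neg] at this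
    linarith
  calc (1 / 2 : ℝ) ^ ((coinCount k + 1) * k + 1) = p ^ k * (1 / 2) ^ (k + 1) := by
        rw [hp, ← pow_mul, ← pow_add]
        ring_nf
    _ ≤ p ^ k * ((1 - p) ^ k) ^ (k + 1) := by gcongr
    _ = p ^ k * (1 - p) ^ (k * (k + 1)) := by rw [pow_mul (1 - p)]
    _ ≤ _ := mul_le_mul (pow_le_pow_of_le_one hp0 hp1 hy)
        (pow_le_pow_of_le_one (by linarith) (by linarith) hh)
        (pow_nonneg (by linarith) _) (pow_nonneg hp0 _)

/-- The factor `10` in `trialCount` makes the expected number of good trials at least `5`, and `exp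
(-5) < 0.01`. -/
theorem one_sub_pow_trialCount_le {k : ℕ} {x : ℝ} (hx : x ≤ 1)
    (h : (1 / 2 : ℝ) ^ ((coinCount k + 1) * k + 1) ≤ x) : (1 - x) ^ trialCount k ≤ 0.01 := by
  have h1 : (1 - x) ^ trialCount k ≤ Real.exp (-x) ^ trialCount k :=
    pow_le_pow_left₀ (by linarith) (by linarith [Real.add_one_le_exp (-x)]) _
  have h2 : (5 : ℝ) ≤ trialCount k * x := by
    have h3 : (trialCount k : ℝ) * (1 / 2 : ℝ) ^ ((coinCount k + 1) * k + 1) = 5 := by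
      rw [trialCount, pow_succ]
      push_cast
      rw [mul_assoc, ← mul_assoc (2 ^ _ : ℝ), ← mul_pow]
      norm_num
    rw [← h3]
    gcongr
  rw [← Real.exp_nat_mul] at h1
  have h4 : Real.exp (trialCount k * -x) ≤ Real.exp (-5) := Real.exp_le_exp.2 (by linarith)
  have h5 : Real.exp (-5) ≤ 0.01 := by
    rw [Real.exp_neg]
    have h6 : (100 : ℝ) ≤ Real.exp 5 := by
      have h7 : Real.exp 5 = Real.exp 1 ^ 5 := by rw [← Real.exp_nat_mul]; norm_num
      rw [h7]
      calc (100 : ℝ) ≤ 2.7 ^ 5 := by norm_num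
        _ ≤ _ := pow_le_pow_left₀ (by norm_num) (by linarith [Real.exp_one_gt_d9]) 5
    calc (Real.exp 5)⁻¹ ≤ (100 : ℝ)⁻¹ := inv_anti₀ (by norm_num) h6
      _ = 0.01 := by norm_num
  linarith

/-- With probability at least `0.99`, some trial keeps all of `Y` and nothing of `H`. -/
theorem le_coinMeasure_exists_trial {n k : ℕ} {Y H : Finset (Fin n)} (h : Disjoint Y H)
    (hY : Y.card ≤ k) (hH : H.card ≤ k * (k + 1)) :
    (0.99 : ℝ) ≤ coinMeasure.real {ω | ∃ t < trialCount k,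
      Y ⊆ sampleSet n (coinCount k) (t * (n * coinCount k)) ω ∧
      Disjoint H (sampleSet n (coinCount k) (t * (n * coinCount k)) ω)} := by
  set b := coinCount k
  set T := trialCount k
  set F : (ℕ → Bool) → Fin T → Fin n → Fin b → Bool :=
    fun ω t i j => ω (t.val * (n * b) + i.val * b + j.val) with hF
  have hFm : Measurable F := by fun_prop
  -- The complement, that all trials are bad, is a box in the product over the trials, so its
  -- probability is a `T`-th power.
  have hset : {ω | ∃ t < T, Y ⊆ sampleSet n b (t * (n * b)) ω ∧
      Disjoint H (sampleSet n b (t * (n * b)) ω)} =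
      F ⁻¹' (Set.pi (Finset.univ : Finset (Fin T)) fun _ => (GoodTrial Y H)ᶜ)ᶜ := by
    have hmem : ∀ (t : Fin T) (i : Fin n) ω,
        i ∈ sampleSet n b (t.val * (n * b)) ω ↔ F ω t i = fun _ => true := by
      intro t i ω
      simp only [sampleSet, Finset.mem_filter, Finset.mem_univ, true_and, hF, funext_iff]
      exact ⟨fun h' j => h' j j.isLt, fun h' j hj => h' ⟨j, hj⟩⟩
    ext ω
    simp only [Set.mem_preimage, Set.mem_compl_iff, Set.mem_pi, Finset.mem_coe, Finset.mem_univ,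
      true_implies, not_forall, not_not, GoodTrial]
    constructor
    · rintro ⟨t, ht, h1, h2⟩
      refine ⟨⟨t, ht⟩, fun i hi => (hmem ⟨t, ht⟩ i ω).1 (h1 hi), fun i hi h' => ?_⟩
      exact Finset.disjoint_left.1 h2 hi ((hmem ⟨t, ht⟩ i ω).2 h')
    · rintro ⟨t, h1, h2⟩
      refine ⟨t, t.isLt, fun i hi => (hmem t i ω).2 (h1 i hi), ?_⟩
      exact Finset.disjoint_left.2 fun i hi h' => h2 i hi ((hmem t i ω).1 h')
  rw [hset, ← map_measureReal_apply hFm .of_discrete, coinMeasure_map,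
    probReal_compl_eq_one_sub .of_discrete]
  have hpi : (Measure.infinitePi fun _ : Fin T => trialLaw n b).real
      (Set.pi (Finset.univ : Finset (Fin T)) fun _ => (GoodTrial Y H)ᶜ) =
      (1 - (trialLaw n b).real (GoodTrial Y H)) ^ T := by
    rw [Measure.real, Measure.infinitePi_pi _ (fun _ _ => .of_discrete), Finset.prod_const,
      ENNReal.toReal_pow, Finset.card_univ, Fintype.card_fin,
      ← probReal_compl_eq_one_sub .of_discrete]
    rfl
  rw [hpi]
  have := one_sub_pow_trialCount_le (k := k) (measureReal_le_one (μ := trialLaw n b)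
    (s := GoodTrial Y H)) ((one_half_pow_le_goodTrial hY hH).trans_eq
      (trialLaw_real_goodTrial h).symm)
  linarith

end Probability

/-! ## The main theorem -/

section Main

variable {n k : ℕ} {G : SimpleGraph (Fin n)} {W Y : Finset (Fin n)}

/-- Few vertices outside a shadow-removable set hit all important separators of its vertices. -/
theorem IsShadowRemovable.exists_hitting_set (h : IsShadowRemovable G k W Y) :
    ∃ H : Finset (Fin n), Disjoint Y H ∧ H.card ≤ k * (k + 1) ∧
      ∀ v ∈ Y, ∀ X, IsImportantSeparator G {v} W X → X.card ≤ k → ¬ Disjoint X H := by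
  have h1 : ∀ v : Fin n, ∃ H : Finset (Fin n), v ∈ Y → H.card ≤ k + 1 ∧ Disjoint H Y ∧
      ∀ X, IsImportantSeparator G {v} W X → X.card ≤ k → ¬ Disjoint X H := by
    intro v
    by_cases hv : v ∈ Y
    · obtain ⟨H, hH⟩ := ShadowRemoval.exists_hitting_set G W Y k v fun X hX hk hXY => by
        have := h.2.2.2 v hv X hX hk
        rw [Finset.sdiff_eq_empty_iff_subset.2 hXY, Finset.card_empty] at this
        omega
      exact ⟨H, fun _ => hH⟩
    · exact ⟨∅, fun h => absurd h hv⟩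
  choose H hH using h1
  refine ⟨Y.biUnion H, ?_, ?_, fun v hv X hX hk hd => ?_⟩
  · rw [Finset.disjoint_biUnion_right]
    exact fun v hv => (hH v hv).2.1.symm
  · calc (Y.biUnion H).card ≤ ∑ v ∈ Y, (H v).card := Finset.card_biUnion_le
      _ ≤ ∑ _v ∈ Y, (k + 1) := Finset.sum_le_sum fun v hv => (hH v hv).1
      _ = Y.card * (k + 1) := by simp
      _ ≤ _ := Nat.mul_le_mul_right _ h.2.1
  · rw [Finset.disjoint_biUnion_right] at hd
    exact (hH v hv).2.2 X hX hk (hd v hv)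

/-- For `k ≥ 2` the base `8 * k` is at most `k ^ 4`. The constant `80` is needed for `k = 1`, where
the bound used is `10 * 8`; for `k = 0` the convention `0 ^ 0 = 1` enters. -/
theorem trialCount_le (k : ℕ) : trialCount k ≤ 80 * k ^ (4 * k) := by
  have h1 : trialCount k = 10 * (2 * 2 ^ coinCount k) ^ k := by
    rw [trialCount, pow_mul, pow_succ, mul_comm 2]
  rw [h1]
  rcases Nat.eq_zero_or_pos k with rfl | hk
  · simp
  have h2 : (2 * 2 ^ coinCount k) ^ k ≤ (8 * k) ^ k :=
    Nat.pow_le_pow_left (by have := two_pow_coinCount_le hk.ne'; omega) k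
  rcases Nat.lt_or_ge 1 k with hk1 | hk1
  · have h3 : 8 * k ≤ k ^ 4 := by
      have : 2 ^ 3 ≤ k ^ 3 := Nat.pow_le_pow_left hk1 3
      calc 8 * k ≤ k ^ 3 * k := Nat.mul_le_mul_right k this
        _ = k ^ 4 := by ring
    have h4 : (8 * k) ^ k ≤ k ^ (4 * k) := by
      rw [pow_mul]
      exact Nat.pow_le_pow_left h3 k
    omega
  · obtain rfl : k = 1 := by omega
    simp only [mul_one, pow_one, one_pow] at h2 ⊢
    omega

theorem self_le_pow (k : ℕ) : k ≤ k ^ (4 * k) := by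
  rcases Nat.eq_zero_or_pos k with rfl | hk
  · simp
  · exact Nat.le_self_pow (by omega) k

theorem rounds_le (n k : ℕ) :
    trialCount k + 2 * n + 2 * k + 2 + 1 ≤ 87 * k ^ (4 * k) * (n + 1) := by
  have h1 := trialCount_le k
  have h2 := self_le_pow k
  have h3 : 1 ≤ k ^ (4 * k) := by
    rcases Nat.eq_zero_or_pos k with rfl | hk
    · simp
    · exact Nat.pow_pos hk
  nlinarith

theorem bound_mono {c d k m : ℕ} (hcd : c ≤ d) (h : 4 * c ≤ d) (n : ℕ) (hm : m ≤ d) :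
    m * k ^ (4 * c * k) * (n + 1) ^ c ≤ d * k ^ (d * k) * (n + 1) ^ d := by
  refine Nat.mul_le_mul (Nat.mul_le_mul hm ?_) (Nat.pow_le_pow_right n.succ_pos hcd)
  rcases Nat.eq_zero_or_pos k with rfl | hk
  · simp
  · exact Nat.pow_le_pow_right hk (Nat.mul_le_mul_right k h)

end Main

end ShadowRemoval

open ShadowRemoval in
theorem mainTheorem3 :
    ∃ (P : ShadowRemoval.Prog) (c : ℕ),
      ∀ (n k : ℕ) (G : SimpleGraph (Fin n)) (W : Finset (Fin n)),
        (∀ ω : ℕ → Bool, ∃ (s : ShadowRemoval.State) (t : ℕ),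
          ShadowRemoval.Exec ω P (ShadowRemoval.inputState G W k) s t ∧
          t ≤ c * k ^ (c * k) * (n + 1) ^ c ∧
          (s.output n).length ≤ c * k ^ (c * k) ∧
          ∀ Z ∈ s.output n, Disjoint Z W) ∧
        ∀ Y : Finset (Fin n), ShadowRemoval.IsShadowRemovable G k W Y →
          (0.99 : ℝ) ≤ ShadowRemoval.coinMeasure.real
            {ω | ∃ (s : ShadowRemoval.State) (t : ℕ),
              ShadowRemoval.Exec ω P (ShadowRemoval.inputState G W k) s t ∧
              ∃ Z ∈ s.output n, Disjoint Y Z ∧ ShadowRemoval.shadow G W Y ⊆ (Z : Set (Fin n))} := by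
  obtain ⟨c, hc⟩ := Prog.exists_time_le shadowProg
  have hspec := fun (n k : ℕ) (G : SimpleGraph (Fin n)) (W : Finset (Fin n)) (ω : ℕ → Bool) =>
    shadowProg_spec (B := trialCount k + 2 * n + 2 * k + 2) G k W ω le_rfl
  have hc0 : c ≤ c * 87 ^ c := Nat.le_mul_of_pos_right _ (by positivity)
  -- The three summands cover the factor in the running time, the exponent `4 * c * k` of `k`, and
  -- the length of the output list.
  refine ⟨shadowProg, c * 87 ^ c + 4 * c + 80, fun n k G W => ⟨fun ω => ?_, fun Y hY => ?_⟩⟩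
  · obtain ⟨s, t, h1, h2, h3, h4⟩ := hspec n k G W ω
    refine ⟨s, t, h1, ?_, ?_, fun Z hZ => ?_⟩
    · calc t ≤ c * (trialCount k + 2 * n + 2 * k + 2 + 1) ^ c := h2.trans (hc _)
        _ ≤ c * (87 * k ^ (4 * k) * (n + 1)) ^ c :=
          Nat.mul_le_mul_left c (Nat.pow_le_pow_left (rounds_le n k) c)
        _ = c * 87 ^ c * k ^ (4 * c * k) * (n + 1) ^ c := by
          rw [mul_pow, mul_pow, ← pow_mul]
          ring_nf
        _ ≤ _ := bound_mono (by omega) (by omega) n (by omega)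
    · have h5 : (s.output n).length = trialCount k := by simp [State.output, h3]
      rw [h5]
      have h6 := bound_mono (c := 1) (d := c * 87 ^ c + 4 * c + 80) (k := k) (m := 80) (by omega)
        (by omega) 0 (by omega)
      simp only [mul_one, zero_add, one_pow] at h6
      exact (trialCount_le k).trans h6
    · simp only [State.output, List.mem_map, List.mem_range] at hZ
      obtain ⟨j, hj, rfl⟩ := hZ
      rw [h3] at hj
      rw [Finset.disjoint_left]
      intro v hv
      exact ((h4 j hj v).1 (Finset.mem_filter.1 hv).2).1
  · obtain ⟨H, hYH, hH, hhit⟩ := hY.exists_hitting_set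
    refine (le_coinMeasure_exists_trial hYH hY.2.1 hH).trans (MeasureTheory.measureReal_mono ?_
      (MeasureTheory.measure_ne_top _ _))
    rintro ω ⟨j, hj, hYU, hHU⟩
    obtain ⟨s, t, h1, -, h3, h4⟩ := hspec n k G W ω
    refine ⟨s, t, h1, Finset.univ.filter fun i : Fin n => s.arr 2 (j * n + i.val) ≠ 0,
      List.mem_map.2 ⟨j, List.mem_range.2 (h3 ▸ hj), rfl⟩, ?_, fun v hv => ?_⟩
    · rw [Finset.disjoint_left]
      intro v hvY hvZ
      obtain ⟨-, X, hX, hXk, hXU⟩ := (h4 j hj v).1 (Finset.mem_filter.1 hvZ).2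
      -- A separator that put `v` into the output would lie in the sample, which misses `H`,
      -- although `H` meets every small important separator of a vertex of `Y`.
      exact hhit v hvY X hX hXk (Finset.disjoint_of_subset_left hXU hHU.symm)
    · obtain ⟨X, hX, hXk, hXY⟩ := hY.2.2.1 v hv
      simp only [Finset.coe_filter, Finset.mem_univ, true_and, Set.mem_ofPred_eq]
      exact (h4 j hj v).2 ⟨hv.1, X, hX, hXk, hXY.trans hYU⟩
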